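/- Let $d\ge 1$, let $\Omega\subset\mathbb R^d$ be open and bounded, $T>0$, and let $\phi\in L^\infty(\Omega)$ with $\phi\ge\phi_*>0$ a.e. Let $f:\mathbb R\times\Omega\times(0,T)\to\mathbb R$ be measurable in $(x,t)$ and Lipschitz continuous in its first variable (uniformly in $(x,t)$), with $f(0,\cdot,\cdot)\in L^\infty(\Omega\times(0,T))$. Let $\mathcal C=(X,\Pi,\nabla,\mathcal I,(t^{(n)})_{n=0,\dots,N})$ be a space-time gradient discretisation: $X$ is a finite-dimensional real vector space, $\Pi:X\to L^\infty(\Omega)$ and $\nabla:X\to L^\infty(\Omega)^d$ are linear, $\mathcal I:L^\infty(\Omega)\to X$ is any map, and $0=t^{(0)}<\dots<t^{(N)}=T$. Put $\delta t^{(n+1/2)}=t^{(n+1)}-t^{(n)}$. Assume that there is $z_1\in X$ with $\Pi z_1=1$ a.e. in $\Omega$. For $n=0,\dots,N-1$ let $\mathbf u^{(n+1)}\in L^2(\Omega)^d$ have distributional divergence $\operatorname{div}\mathbf u^{(n+1)}\in L^\infty(\Omega)$, and let $F_t=F^{(n+1)}_t$, $t\in[-T,T]$, be a flow of $\mathbf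 u^{(n+1)}/\phi$ in $\Omega$. That is: $F_t$ maps $\Omega$ to $\Omega$; for a.e. $x\in\Omega$ the function $s\mapsto \mathbf u^{(n+1)}(F_s(x))/\phi(F_s(x))$ is integrable on $(-T,T)$ and $$F_t(x)=x+\int_0^t\frac{\mathbf u^{(n+1)}(F_s(x))}{\phi(F_s(x))}\,ds\qquad\text{for all }t\in[-T,T];$$ for all $s,t$ with $s,t,s+t\in[-T,T]$, $F_s\circ F_t=F_{s+t}$ a.e. in $\Omega$; and there is an open set $\Omega_0\subset\Omega$ with $|\Omega\setminus\Omega_0|=0$ such that each $F_t$ restricts to a homeomorphism of $\Omega_0$ onto an open set and each $x\in\Omega_0$ has a neighbourhood on which all the $F_t$, $t\in[-T,T]$, are bi-Lipschitz with a common constant. Let $w\in[0,1]$ and $c_{\rm ini}\in L^\infty(\Omega)$. Suppose that $(c^{(n)})_{n=0,\dots,N}\in X^{N+1}$ solves the MMOC scheme, that is, $c^{(0)}=\mathcal I c_{\rm ini}$ and, for all $n=0,\dots,N-1$ and all $z\in X$, $$\int_\Omega \phi\,\Pi c^{(n+1)}\,\Pi z\,dx-\int_\Omega\phi\,(\Pi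 c^{(n)}\circ F_{-\delta t^{(n+1/2)}})\,\Pi z\,dx=\delta t^{(n+1/2)}\int_\Omega\Big[wf_n+(1-w)f_{n+1}-\big(w\Pi c^{(n)}+(1-w)\Pi c^{(n+1)}\big)\operatorname{div}\mathbf u^{(n+1)}\Big]\Pi z\,dx.$$ Here, for each $k$, $f_k(x)=f(\Pi c^{(k)}(x),x,t^{(k)})$ if $f$ is continuous in time on $[0,T]$, or $f_k(x)=\int f(\Pi c^{(k)}(x),x,s)\,d\sigma_k(s)$ for some probability measure $\sigma_k$ absolutely continuous with respect to Lebesgue measure on $(0,T)$ (a time average). For $n=0,\dots,N-1$ define the discrete mass balance error $$e_{\rm mass}=\left|\int_\Omega\phi\,\Pi c^{(n+1)}dx-\int_\Omega\phi\,\Pi c^{(n)}dx-\delta t^{(n+1/2)}\int_\Omega\big(wf_n+(1-w)f_{n+1}\big)dx\right|.$$ Then, for every $n=0,\dots,N-1$, the source integrand $wf_n+(1-w)f_{n+1}$ in $e_{\rm mass}$ is integrable on $\Omega$, the two integrands on the right-hand side below are integrable on $(0,\delta t^{(n+1/2)})\times\Omega$, and $$\begin{aligned}e_{\rm mass}\le{}&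 w\left|\int_0^{\delta t^{(n+1/2)}}\!\!\int_\Omega\big(\Pi c^{(n)}(F_{-t}(x))-\Pi c^{(n)}(x)\big)\operatorname{div}\mathbf u^{(n+1)}(x)\,dx\,dt\right|\\&+(1-w)\left|\int_0^{\delta t^{(n+1/2)}}\!\!\int_\Omega\big(\Pi c^{(n)}(F_{-t}(x))-\Pi c^{(n+1)}(x)\big)\operatorname{div}\mathbf u^{(n+1)}(x)\,dx\,dt\right|.\end{aligned}$$ In particular, if $\operatorname{div}\mathbf u^{(n+1)}=0$ a.e. in $\Omega$, then $e_{\rm mass}=0$. -/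

import Mathlib

open MeasureTheory Set Topology
open scoped NNReal ENNReal

noncomputable section

namespace MMOC

/-- The space `ℝ^d` with its Euclidean norm. -/
abbrev Space (d : ℕ) := EuclideanSpace ℝ (Fin d)

/-- `D` is the divergence of `u` in the sense of distributions on the open set `Ω`:
`∫_Ω ∇ψ · u = - ∫_Ω ψ D` for every `ψ ∈ C_c^∞(Ω)`. -/
def IsWeakDiv {d : ℕ} (Ω : Set (Space d)) (u : Space d → Space d) (D : Space d → ℝ) : Prop :=
  ∀ ψ : Space d → ℝ, ContDiff ℝ (⊤ : ℕ∞) ψ → HasCompactSupport ψ → tsupport ψ ⊆ Ω →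
    ∫ x in Ω, fderiv ℝ ψ x (u x) = - ∫ x in Ω, ψ x * D x

/-- A space-time gradient discretisation `(X, Π, ∇, I, (t⁽ⁿ⁾)_{n = 0, …, N})` of `Ω × (0, T)`.
Only the values `t 0, …, t N` of the sequence `t` are meaningful. -/
structure GradientDiscretisation {d : ℕ} (Ω : Set (Space d)) (T : ℝ)
    (X : Type*) [AddCommGroup X] [Module ℝ X] where
  /-- reconstruction of functions -/
  recon : X →ₗ[ℝ] Lp ℝ ⊤ (volume.restrict Ω)
  /-- reconstruction of gradients -/
  grad : X →ₗ[ℝ] Lp (Space d) ⊤ (volume.restrict Ω)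
  /-- interpolation of the initial condition -/
  interp : Lp ℝ ⊤ (volume.restrict Ω) → X
  /-- number of time steps -/
  N : ℕ
  /-- time instants -/
  t : ℕ → ℝ
  t_zero : t 0 = 0
  t_last : t N = T
  t_lt : ∀ n < N, t n < t (n + 1)

/-- The time step `δt^{(n + 1/2)} = t⁽ⁿ⁺¹⁾ - t⁽ⁿ⁾`. -/
def GradientDiscretisation.dt {d : ℕ} {Ω : Set (Space d)} {T : ℝ}
    {X : Type*} [AddCommGroup X] [Module ℝ X]
    (C : GradientDiscretisation Ω T X) (n : ℕ) : ℝ :=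
  C.t (n + 1) - C.t n

/-- `F` is the flow on `Ω`, for times in `[-T, T]`, of `dF_t(x)/dt = u(F_t(x)) / φ(F_t(x))`,
`F_0(x) = x`.

Since `u` and `φ` are only Lebesgue functions, the equation is the Carathéodory one, i.e. the
integral equation along the trajectories, and holds for almost every starting point; the same
is true of the flow (group) property. The field `regular` is the spatial regularity that gives a
meaning to the Jacobian of `F_t` and to changes of variables by `F_t`: on an open set of full
measure, every `F_t` is a homeomorphism onto an open set and is locally bi-Lipschitz, locally
uniformly for `t ∈ [-T, T]`. Discontinuities of `F_t` are allowed outside this set. -/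
structure IsFlow {d : ℕ} (Ω : Set (Space d)) (T : ℝ) (φ : Space d → ℝ)
    (u : Space d → Space d) (F : ℝ → Space d → Space d) : Prop where
  mapsTo : ∀ t ∈ Icc (-T) T, MapsTo (F t) Ω Ω
  ode : ∀ᵐ x ∂(volume.restrict Ω),
    IntervalIntegrable (fun s => (φ (F s x))⁻¹ • u (F s x)) volume (-T) T ∧
    ∀ t ∈ Icc (-T) T, F t x = x + ∫ s in (0 : ℝ)..t, (φ (F s x))⁻¹ • u (F s x)
  group : ∀ s ∈ Icc (-T) T, ∀ t ∈ Icc (-T) T, s + t ∈ Icc (-T) T →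
    ∀ᵐ x ∂(volume.restrict Ω), F s (F t x) = F (s + t) x
  regular : ∃ Ω₀ : Set (Space d), IsOpen Ω₀ ∧ Ω₀ ⊆ Ω ∧ volume (Ω \ Ω₀) = 0 ∧
    (∀ t ∈ Icc (-T) T, IsOpenEmbedding (Ω₀.domRestrict (F t))) ∧
    ∀ x ∈ Ω₀, ∃ K : ℝ, ∃ U ∈ 𝓝 x, ∀ t ∈ Icc (-T) T, ∀ y ∈ U, ∀ z ∈ U,
      dist (F t y) (F t z) ≤ K * dist y z ∧ dist y z ≤ K * dist (F t y) (F t z)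

/-- Lebesgue measure on the space-time cylinder `Q_T = Ω × (0, T)`. -/
def cylinderMeasure {d : ℕ} (Ω : Set (Space d)) (T : ℝ) : Measure (Space d × ℝ) :=
  (volume.restrict Ω).prod (volume.restrict (Ioo 0 T))

/-- Source terms `f(c, x, t)`: Lipschitz with respect to `c` (uniformly in `(x, t)`), measurable
with respect to `(x, t)`, with `f(0, ·, ·) ∈ L^∞(Q_T)`. -/
structure IsSource {d : ℕ} (Ω : Set (Space d)) (T : ℝ) (f : ℝ → Space d → ℝ → ℝ) : Prop where
  meas : ∀ r, AEStronglyMeasurable (fun p : Space d × ℝ => f r p.1 p.2) (cylinderMeasure Ω T)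
  lip : ∃ L : ℝ≥0, ∀ᵐ p ∂(cylinderMeasure Ω T), LipschitzWith L (fun r => f r p.1 p.2)
  bdd : MemLp (fun p : Space d × ℝ => f 0 p.1 p.2) ⊤ (cylinderMeasure Ω T)

/-- The ways of freezing `f` at the instant `τ`: either evaluation at `τ` (`σ` is the Dirac mass
at `τ`), for `f` continuous in time, or a time average (`σ` is a probability measure with a
density on `(0, T)`, for instance the uniform one on an interval). -/
def IsTimeSampling {d : ℕ} (Ω : Set (Space d)) (T : ℝ) (f : ℝ → Space d → ℝ → ℝ)
    (τ : ℝ) (σ : Measure ℝ) : Prop :=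
  (σ = Measure.dirac τ ∧
    ∀ᵐ x ∂(volume.restrict Ω), ∀ r, ContinuousOn (fun s => f r x s) (Icc 0 T)) ∨
  (IsProbabilityMeasure σ ∧ σ ≪ volume.restrict (Ioo 0 T))

/-- The frozen source `x ↦ ∫ f(v(x), x, s) dσ(s)`; it is `x ↦ f(v(x), x, τ)` if `σ` is the Dirac
mass at `τ`. -/
def frozenSource {d : ℕ} (f : ℝ → Space d → ℝ → ℝ) (σ : Measure ℝ) (v : Space d → ℝ)
    (x : Space d) : ℝ :=
  ∫ s, f (v x) x s ∂σ

/-- `g^{(n,w)} · e = w g⁽ⁿ⁾ + (1 - w) g⁽ⁿ⁺¹⁾`, where `g^{(n,w)} = (w g⁽ⁿ⁾, (1 - w) g⁽ⁿ⁺¹⁾)` and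
`e = (1, 1)`. -/
def weighted {d : ℕ} (w : ℝ) (g : ℕ → Space d → ℝ) (n : ℕ) (x : Space d) : ℝ :=
  w * g n x + (1 - w) * g (n + 1) x

section Scheme

variable {d : ℕ} {Ω : Set (Space d)} {T : ℝ} {X : Type*} [AddCommGroup X] [Module ℝ X]

/-- `f_k = f(Π c⁽ᵏ⁾, ·, t⁽ᵏ⁾)`, or its time-averaged version. -/
def discreteSource (C : GradientDiscretisation Ω T X) (f : ℝ → Space d → ℝ → ℝ)
    (σ : ℕ → Measure ℝ) (c : ℕ → X) (k : ℕ) : Space d → ℝ :=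
  frozenSource f (σ k) (C.recon (c k))

/-- The family `(c⁽ⁿ⁾)_{n = 0, …, N}` (only these values of the sequence `c` matter) solves the
MMOC scheme. Here `F (n + 1)` is the flow of `u⁽ⁿ⁺¹⁾ / φ` and `divu (n + 1) = div u⁽ⁿ⁺¹⁾`. -/
def IsMMOCSolution (C : GradientDiscretisation Ω T X) (φ : Space d → ℝ)
    (divu : ℕ → Space d → ℝ) (F : ℕ → ℝ → Space d → Space d)
    (f : ℝ → Space d → ℝ → ℝ) (σ : ℕ → Measure ℝ) (w : ℝ)
    (cini : Lp ℝ ⊤ (volume.restrict Ω)) (c : ℕ → X) : Prop :=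
  c 0 = C.interp cini ∧
  ∀ n < C.N, ∀ z : X,
    (∫ x in Ω, φ x * C.recon (c (n + 1)) x * C.recon z x)
      - (∫ x in Ω, φ x * C.recon (c n) (F (n + 1) (-(C.dt n)) x) * C.recon z x)
    = C.dt n * ∫ x in Ω,
        (weighted w (discreteSource C f σ c) n x
          - weighted w (fun k => C.recon (c k)) n x * divu (n + 1) x) * C.recon z x

/-- The discrete mass balance error
`e_mass = |∫_Ω φ Π c⁽ⁿ⁺¹⁾ - ∫_Ω φ Π c⁽ⁿ⁾ - δt^{(n + 1/2)} ∫_Ω f^{(n,w)} · e|`. -/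
def massBalanceError (C : GradientDiscretisation Ω T X) (φ : Space d → ℝ)
    (f : ℝ → Space d → ℝ → ℝ) (σ : ℕ → Measure ℝ) (w : ℝ) (c : ℕ → X) (n : ℕ) : ℝ :=
  |(∫ x in Ω, φ x * C.recon (c (n + 1)) x) - (∫ x in Ω, φ x * C.recon (c n) x)
    - C.dt n * ∫ x in Ω, weighted w (discreteSource C f σ c) n x|

end Scheme

end MMOC

end

/-! Testing the scheme with `z₁` removes the test function, so all that separates the scheme from
exact conservation is the change from `∫ φ Πc⁽ⁿ⁾` to `∫ φ Πc⁽ⁿ⁾ ∘ F_{-δt}` and the divergence terms.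
The change is given by the balance `IsFlow.integral_balance`: for bounded `v`, `∫ φ v ∘ F_{-τ} - ∫ φ
v = ∫₀^τ ∫ (v ∘ F_{-t}) div u`. Inserting it, and splitting the right-hand side with weights `w` and
`1 - w`, writes the signed mass defect as the weighted sum of the two integrals in the bound; the
triangle inequality concludes.

Formally, the balance is the transport equation for `v ∘ F_{-t}` integrated by parts. Since `v` is
only bounded, it is first proved for a Lipschitz `g` vanishing off a compact set `S` inside a
bi-Lipschitz chart `U` (`LocalData.integral_balance`). At a fixed time `t`, the function `G = g ∘
F_t⁻¹` is Lipschitz with compact support, and `g ∘ F_{-s} = G ∘ F_{-(s-t)}` a.e. Integrating `∇G · u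
/ φ` along trajectories and testing the weak divergence with `G`
(`IsWeakDiv.integral_fderiv_lipschitz`) gives the right derivative at `s = t`. No Jacobian is used:
bi-Lipschitz bounds control the volume distortion by `K^(2d)` (`IsFlow.map_restrict_le`).

To reach bounded `v`, both sides are read as integrals of `v` against finite measures absolutely
continuous with respect to Lebesgue measure. Lipschitz functions determine these measures near every
regular point, and countably many such neighbourhoods carry all the mass. -/

namespace MMOC
open Filter

/-! ### Volume distortion of Lipschitz maps -/

section Geometry

/-- A `K`-Lipschitz map multiplies the Lebesgue measure by at most `K ^ d`. -/
theorem volume_image_le_of_lipschitzOnWith {d : ℕ} {K : ℝ≥0} {f : Space d → Space d}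
    {s : Set (Space d)} (h : LipschitzOnWith K f s) :
    volume (f '' s) ≤ (K : ℝ≥0∞) ^ d * volume s := by
  have hd : Module.finrank ℝ (Space d) = d := by simp
  have key := h.hausdorffMeasure_image_le (d := (d : ℝ)) (by positivity)
  -- By uniqueness of Haar measure, the `d`-dimensional Hausdorff measure and the volume are
  -- proportional, so the Hausdorff estimate transfers whatever the constant.
  have hc := Measure.isAddLeftInvariant_eq_smul (volume : Measure (Space d))
    (Measure.hausdorffMeasure (d : ℝ))
  rw [hc]
  simp only [Measure.smul_apply, ENNReal.smul_def, smul_eq_mul, ENNReal.rpow_natCast] at key ⊢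
  calc _ ≤ _ * ((K : ℝ≥0∞) ^ d * _) := by gcongr
    _ = _ := by ring

end Geometry

/-! ### Chain rule along absolutely continuous curves -/

section Chain

variable {E : Type*} [NormedAddCommGroup E] [NormedSpace ℝ E]

/-- A Lipschitz function composed with an indefinite integral is absolutely continuous. -/
theorem absolutelyContinuousOnInterval_comp_integral {G : E → ℝ} {L : ℝ≥0}
    (hG : LipschitzWith L G) {γ b : ℝ → E} {p q : ℝ} {x : E} {c : ℝ}
    (hb : IntervalIntegrable b volume p q) (hc : c ∈ uIcc p q)
    (hγ : ∀ t ∈ uIcc p q, γ t = x + ∫ s in c..t, b s) :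
    AbsolutelyContinuousOnInterval (fun t => G (γ t)) p q := by
  have hB := hb.norm.absolutelyContinuousOnInterval_intervalIntegral (c := c) hc
  -- The increments of `L ∫ ‖b‖` dominate those of `G ∘ γ`, so the `δ` of this majorant serves for
  -- `G ∘ γ`.
  have hB' := hB.const_mul L
  rw [absolutelyContinuousOnInterval_iff] at hB' ⊢
  intro ε hε
  obtain ⟨δ, hδ, H⟩ := hB' ε hε
  refine ⟨δ, hδ, fun E' hE hlt => lt_of_le_of_lt ?_ (H E' hE hlt)⟩
  refine Finset.sum_le_sum fun i hi => ?_
  have hmem := hE.1 i hi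
  have h1 := hmem.1
  have h2 := hmem.2
  have hint : ∀ r ∈ uIcc p q, ∀ r' ∈ uIcc p q, IntervalIntegrable b volume r r' :=
    fun r hr r' hr' => hb.mono_set (uIcc_subset_uIcc hr hr')
  set r := (E'.2 i).1
  set r' := (E'.2 i).2
  calc dist (G (γ r)) (G (γ r')) ≤ L * dist (γ r) (γ r') := hG.dist_le_mul _ _
    _ = L * ‖∫ s in r'..r, b s‖ := by
        rw [hγ r h1, hγ r' h2, dist_add_left, dist_eq_norm,
          intervalIntegral.integral_interval_sub_left (hint _ hc _ h1) (hint _ hc _ h2)]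
    _ ≤ L * |∫ s in r'..r, ‖b s‖| := by
        gcongr; exact intervalIntegral.norm_integral_le_abs_integral_norm
    _ = dist (L * ∫ s in c..r, ‖b s‖) (L * ∫ s in c..r', ‖b s‖) := by
        rw [← intervalIntegral.integral_interval_sub_left (hint _ hc _ h1).norm
          (hint _ hc _ h2).norm, Real.dist_eq, ← mul_sub, abs_mul, NNReal.abs_eq]

/-- Fundamental theorem of calculus for a Lipschitz function along an absolutely continuous
curve. -/
theorem integral_fderiv_comp_eq_sub [CompleteSpace E] {G : E → ℝ} {L : ℝ≥0}
    (hG : LipschitzWith L G) {γ b : ℝ → E} {p q : ℝ} {x : E} {c : ℝ}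
    (hb : IntervalIntegrable b volume p q) (hc : c ∈ uIcc p q)
    (hγ : ∀ t ∈ uIcc p q, γ t = x + ∫ s in c..t, b s)
    (hdiff : ∀ᵐ s, s ∈ uIcc p q → DifferentiableAt ℝ G (γ s)) :
    ∫ s in p..q, fderiv ℝ G (γ s) (b s) = G (γ q) - G (γ p) := by
  -- Rademacher's theorem alone would not justify the chain rule here, because a given curve may
  -- stay inside the exceptional null set; this is the role of `hdiff`.
  rw [← (absolutelyContinuousOnInterval_comp_integral hG hb hc hγ).integral_deriv_eq_sub]
  refine intervalIntegral.integral_congr_ae ?_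
  have hne : ∀ r : ℝ, ∀ᵐ s : ℝ, s ≠ r := fun r => by simp [ae_iff, measure_singleton]
  filter_upwards [hdiff, hb.ae_hasDerivAt_integral, hne p, hne q] with s hs hs' hp hq hmem
  have hmem' : s ∈ uIcc p q := uIoc_subset_uIcc hmem
  have hnhds : uIcc p q ∈ 𝓝 s := by
    rw [uIoc, mem_Ioc] at hmem
    rw [uIcc]
    refine Icc_mem_nhds hmem.1 (lt_of_le_of_ne hmem.2 ?_)
    rcases max_choice p q with h | h <;> rw [h] <;> assumption
  have hd : HasDerivAt γ (b s) s := by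
    refine ((hs' hmem' c hc).const_add x).congr_of_eventuallyEq ?_
    filter_upwards [hnhds] with t ht using hγ t ht
  exact ((hs hmem').hasFDerivAt.comp_hasDerivAt s hd).deriv.symm

end Chain

/-! ### Lipschitz test functions for the weak divergence -/

section WeakDiv

variable {d : ℕ}

/-- Differentiation of the mollification of a Lipschitz function. -/
theorem hasFDerivAt_convolution_of_lipschitz {η g : Space d → ℝ} {L : ℝ≥0}
    (hη : Continuous η) (hηc : HasCompactSupport η) (hg : LipschitzWith L g) (x : Space d) :
    HasFDerivAt (fun x => ∫ y, η y * g (x - y)) (∫ y, η y • fderiv ℝ g (x - y)) x := by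
  have hηi : Integrable η := hη.integrable_of_hasCompactSupport hηc
  -- The derivative falls on `g`: the integrand is Lipschitz in `x` with constant `L |η y|`, and
  -- Rademacher gives differentiability at `x - y` for a.e. `y`.
  refine (hasFDerivAt_integral_of_dominated_loc_of_lip
    (F := fun x y => η y * g (x - y)) (F' := fun y => η y • fderiv ℝ g (x - y))
    (bound := fun y => L * ‖η y‖) (Metric.ball_mem_nhds x one_pos) ?_ ?_ ?_ ?_ ?_ ?_).2
  · exact .of_forall fun z =>
      (hη.mul (hg.continuous.comp (continuous_const.sub continuous_id))).aestronglyMeasurable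
  · exact (hη.mul (hg.continuous.comp
      (continuous_const.sub continuous_id))).integrable_of_hasCompactSupport hηc.mul_right
  · exact hη.aestronglyMeasurable.smul
      ((measurable_fderiv ℝ g).comp (measurable_const.sub measurable_id)).aestronglyMeasurable
  · refine .of_forall fun y => ?_
    refine LipschitzOnWith.of_dist_le_mul fun a _ b _ => ?_
    have := hg.dist_le_mul (a - y) (b - y)
    rw [dist_sub_right] at this
    simp only [Real.dist_eq, ← mul_sub, abs_mul] at this ⊢
    rw [Real.nnabs_of_nonneg (by positivity), Real.coe_toNNReal _ (by positivity)]
    calc |η y| * |g (a - y) - g (b - y)| ≤ |η y| * (L * dist a b) := by gcongr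
      _ = _ := by rw [Real.norm_eq_abs]; ring
  · exact hηi.norm.const_mul _
  · have : ∀ᵐ y : Space d, DifferentiableAt ℝ g (x - y) :=
      (Measure.measurePreserving_sub_left volume x).quasiMeasurePreserving.ae hg.ae_differentiableAt
    filter_upwards [this] with y hy
    have h := hy.hasFDerivAt.comp x ((hasFDerivAt_id x).sub_const y)
    rw [ContinuousLinearMap.comp_id] at h
    exact h.const_mul (η y)

/-- The weak divergence may be tested against compactly supported Lipschitz functions. -/
theorem IsWeakDiv.integral_fderiv_lipschitz {Ω : Set (Space d)} (hΩ : IsOpen Ω)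
    {u : Space d → Space d} {D : Space d → ℝ} (h : IsWeakDiv Ω u D)
    (hu : IntegrableOn u Ω) (hD : IntegrableOn D Ω)
    {g : Space d → ℝ} {L : ℝ≥0} (hg : LipschitzWith L g) (hgc : HasCompactSupport g)
    (hgΩ : tsupport g ⊆ Ω) :
    ∫ x in Ω, fderiv ℝ g x (u x) = - ∫ x in Ω, g x * D x := by
  -- The ratio of outer to inner radius stays equal to 2: a bounded ratio is what the a.e.
  -- convergence of the mollified gradients requires.
  let φ : ℕ → ContDiffBump (0 : Space d) := fun n =>
    ⟨1 / ((n : ℝ) + 1), 2 * (1 / ((n : ℝ) + 1)), by positivity, by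
      have : (0 : ℝ) < 1 / ((n : ℝ) + 1) := by positivity
      linarith⟩
  have hφ : Tendsto (fun n => (φ n).rOut) atTop (𝓝 0) := by
    change Tendsto (fun n : ℕ => 2 * (1 / ((n : ℝ) + 1))) atTop (𝓝 0)
    simpa using tendsto_one_div_add_atTop_nhds_zero_nat.const_mul (2 : ℝ)
  let ψ : ℕ → Space d → ℝ := fun n x => ∫ y, (φ n).normed volume y * g (x - y)
  have hψ : ∀ n, ψ n = convolution ((φ n).normed volume) g (ContinuousLinearMap.lsmul ℝ ℝ)
      volume := by
    intro n; ext x; simp [ψ, convolution]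
  have hψd : ∀ n x, HasFDerivAt (ψ n) (∫ y, (φ n).normed volume y • fderiv ℝ g (x - y)) x :=
    fun n x => hasFDerivAt_convolution_of_lipschitz (φ n).continuous_normed
      (φ n).hasCompactSupport_normed hg x
  have hψd_norm : ∀ n x, ‖fderiv ℝ (ψ n) x‖ ≤ L := by
    intro n x
    rw [(hψd n x).fderiv]
    calc _ ≤ ∫ y, (φ n).normed volume y * L := by
          refine norm_integral_le_of_norm_le ((φ n).integrable_normed.mul_const _)
            (.of_forall fun y => ?_)
          rw [norm_smul, Real.norm_of_nonneg ((φ n).nonneg_normed y)]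
          exact mul_le_mul_of_nonneg_left (norm_fderiv_le_of_lipschitz ℝ hg)
            ((φ n).nonneg_normed y)
      _ = L := by rw [integral_mul_const, (φ n).integral_normed, one_mul]
  obtain ⟨M, hM⟩ := hgc.exists_bound_of_continuous hg.continuous
  have hψ_norm : ∀ n x, ‖ψ n x‖ ≤ M := by
    intro n x
    calc _ ≤ ∫ y, (φ n).normed volume y * M := by
          refine norm_integral_le_of_norm_le ((φ n).integrable_normed.mul_const _)
            (.of_forall fun y => ?_)
          rw [norm_mul, Real.norm_of_nonneg ((φ n).nonneg_normed y)]
          exact mul_le_mul_of_nonneg_left (hM _) ((φ n).nonneg_normed y)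
      _ = M := by rw [integral_mul_const, (φ n).integral_normed, one_mul]
  have hψ_lim : ∀ x, Tendsto (fun n => ψ n x) atTop (𝓝 (g x)) := by
    intro x
    simp_rw [hψ]
    exact ContDiffBump.convolution_tendsto_right_of_continuous hφ hg.continuous x
  have hψd_lim : ∀ᵐ x : Space d, Tendsto (fun n => fderiv ℝ (ψ n) x) atTop
      (𝓝 (fderiv ℝ g x)) := by
    -- The gradient of `g` is merely bounded and measurable, so its mollifications converge only
    -- almost everywhere; with the uniform bound `L` this suffices for dominated convergence against
    -- `u`.
    have hloc : LocallyIntegrable (fderiv ℝ g) (volume : Measure (Space d)) :=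
      (memLp_top_of_bound (measurable_fderiv ℝ g).aestronglyMeasurable (L : ℝ)
        (.of_forall fun x => norm_fderiv_le_of_lipschitz ℝ hg)).locallyIntegrable le_top
    filter_upwards [ContDiffBump.ae_convolution_tendsto_right_of_locallyIntegrable
      (φ := φ) (K := 2) hφ (.of_forall fun n => le_rfl) hloc] with x hx
    refine hx.congr fun n => ?_
    rw [(hψd n x).fderiv]
    simp [convolution]
  have hψ_supp : ∀ᶠ n in atTop, tsupport (ψ n) ⊆ Ω := by
    obtain ⟨δ, hδ, hsub⟩ := hgc.isCompact.exists_cthickening_subset_open hΩ hgΩ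
    filter_upwards [hφ.eventually (gt_mem_nhds hδ)] with n hn
    refine subset_trans (closure_minimal ?_ Metric.isClosed_cthickening) hsub
    rw [hψ]
    refine (support_convolution_subset (ContinuousLinearMap.lsmul ℝ ℝ)).trans ?_
    rw [(φ n).support_normed_eq]
    rintro _ ⟨a, ha, b, hb, rfl⟩
    refine Metric.mem_cthickening_of_dist_le (a + b) b δ _ (subset_tsupport _ hb) ?_
    simp only [Metric.mem_ball, dist_zero_right] at ha
    simpa [dist_eq_norm] using (ha.trans hn).le
  have hψ_eq : ∀ᶠ n in atTop, ∫ x in Ω, fderiv ℝ (ψ n) x (u x) = - ∫ x in Ω, ψ n x * D x := by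
    filter_upwards [hψ_supp] with n hn
    refine h (ψ n) ?_ ?_ hn
    · rw [hψ]
      exact HasCompactSupport.contDiff_convolution_left _ (φ n).hasCompactSupport_normed
        (φ n).contDiff_normed hg.continuous.locallyIntegrable
    · rw [hψ]
      exact (φ n).hasCompactSupport_normed.convolution _ hgc
  have lim1 : Tendsto (fun n => ∫ x in Ω, fderiv ℝ (ψ n) x (u x)) atTop
      (𝓝 (∫ x in Ω, fderiv ℝ g x (u x))) := by
    refine tendsto_integral_of_dominated_convergence (fun x => L * ‖u x‖) (fun n => ?_)
      (hu.norm.const_mul _) (fun n => .of_forall fun x => ?_) ?_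
    · exact (ContinuousLinearMap.apply ℝ ℝ : Space d →L[ℝ] _).flip.aestronglyMeasurable_comp₂
        (measurable_fderiv ℝ (ψ n)).aestronglyMeasurable hu.aestronglyMeasurable
    · exact ((fderiv ℝ (ψ n) x).le_opNorm _).trans (by gcongr; exact hψd_norm n x)
    · filter_upwards [ae_restrict_of_ae hψd_lim] with x hx
      exact ((ContinuousLinearMap.apply ℝ ℝ (u x)).continuous.tendsto _).comp hx
  have lim2 : Tendsto (fun n => ∫ x in Ω, ψ n x * D x) atTop (𝓝 (∫ x in Ω, g x * D x)) := by
    refine tendsto_integral_of_dominated_convergence (fun x => M * ‖D x‖) (fun n => ?_)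
      (hD.norm.const_mul _) (fun n => .of_forall fun x => ?_) ?_
    · have : Continuous (ψ n) :=
        continuous_iff_continuousAt.2 fun x => (hψd n x).continuousAt
      exact this.aestronglyMeasurable.mul hD.aestronglyMeasurable
    · rw [norm_mul]; gcongr; exact hψ_norm n x
    · exact .of_forall fun x => (hψ_lim x).mul_const _
  exact tendsto_nhds_unique (lim1.congr' hψ_eq) lim2.neg

end WeakDiv

/-! ### Inverse Lipschitz bounds and extension by zero -/

section Geometry

/-- If distances are contracted by at most `K` under `f`, then so is the Lebesgue measure, up to a
power `d`. -/
theorem volume_le_of_antilipschitzOn {d : ℕ} {K : ℝ≥0} {f : Space d → Space d}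
    {s : Set (Space d)} (h : ∀ y ∈ s, ∀ z ∈ s, dist y z ≤ K * dist (f y) (f z)) :
    volume s ≤ (K : ℝ≥0∞) ^ d * volume (f '' s) := by
  have hinj : InjOn f s := by
    intro y hy z hz hyz
    have := h y hy z hz
    rw [hyz, dist_self, mul_zero] at this
    exact dist_le_zero.1 this
  have hleft := hinj.leftInvOn_invFunOn
  have hlip : LipschitzOnWith K (Function.invFunOn f s) (f '' s) := by
    refine LipschitzOnWith.of_dist_le_mul ?_
    rintro _ ⟨y, hy, rfl⟩ _ ⟨z, hz, rfl⟩
    rw [hleft hy, hleft hz]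
    exact h y hy z hz
  have := volume_image_le_of_lipschitzOnWith hlip
  rwa [hleft.image_image] at this

/-- A bounded function which is Lipschitz on a neighbourhood of a compact set and vanishes off this
compact set is Lipschitz. -/
theorem exists_lipschitzWith_of_lipschitzOnWith {E : Type*} [PseudoMetricSpace E]
    {G : E → ℝ} {V S : Set E} {L : ℝ≥0} {M : ℝ} (hG : LipschitzOnWith L G V) (hS : IsCompact S)
    (hV : IsOpen V) (hSV : S ⊆ V) (h0 : ∀ x ∉ S, G x = 0) (hM : ∀ x, |G x| ≤ M) :
    ∃ L' : ℝ≥0, LipschitzWith L' G := by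
  obtain ⟨δ, hδ, hsub⟩ := hS.exists_thickening_subset_open hV hSV
  by_cases hE : Nonempty E
  swap
  · exact ⟨0, fun x => (hE ⟨x⟩).elim⟩
  have hM0 : 0 ≤ M := (abs_nonneg _).trans (hM hE.some)
  -- `L` serves points closer than `δ`: if one lies in `S`, both lie in `V`. Beyond `δ`, the
  -- oscillation `2 * M` is at most `(2 * M / δ)` times the distance.
  refine ⟨max L (2 * M / δ).toNNReal, LipschitzWith.of_dist_le_mul fun x y => ?_⟩
  have hcoe : ((2 * M / δ).toNNReal : ℝ) = 2 * M / δ := Real.coe_toNNReal _ (by positivity)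
  have near : ∀ x y, x ∈ S → dist x y < δ → dist (G x) (G y) ≤ L * dist x y := by
    intro x y hx hxy
    refine hG.dist_le_mul x (hSV hx) y (hsub ?_)
    exact Metric.mem_thickening_iff.2 ⟨x, hx, by rwa [dist_comm]⟩
  have hle : (L : ℝ) * dist x y ≤ (max L (2 * M / δ).toNNReal : ℝ≥0) * dist x y := by
    gcongr; exact le_max_left _ _
  rcases lt_or_ge (dist x y) δ with hlt | hge
  · by_cases hx : x ∈ S
    · exact (near x y hx hlt).trans hle
    by_cases hy : y ∈ S
    · rw [dist_comm (G x), dist_comm x] at *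
      exact (near y x hy hlt).trans hle
    · rw [h0 x hx, h0 y hy, dist_self]; positivity
  · calc dist (G x) (G y) ≤ 2 * M := by
          rw [Real.dist_eq]
          have := abs_le.1 (hM x)
          have := abs_le.1 (hM y)
          rw [abs_le]
          constructor <;> linarith
      _ = (2 * M / δ) * δ := by field_simp
      _ ≤ (2 * M / δ) * dist x y := by gcongr
      _ ≤ _ := by
          gcongr; exact hcoe.ge.trans (NNReal.coe_le_coe.2 (le_max_right _ _))

end Geometry

/-! ### Null sets and measurability under the flow -/

section Flow

variable {d : ℕ} {Ω Ω₀ : Set (Space d)} {T : ℝ} {φ : Space d → ℝ} {u : Space d → Space d}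
  {F : ℝ → Space d → Space d}

/-- The set `Ω₀` of regular points of a flow. -/
structure IsRegularSet (Ω : Set (Space d)) (T : ℝ) (F : ℝ → Space d → Space d)
    (Ω₀ : Set (Space d)) : Prop where
  isOpen : IsOpen Ω₀
  subset : Ω₀ ⊆ Ω
  null : volume (Ω \ Ω₀) = 0
  emb : ∀ t ∈ Icc (-T) T, IsOpenEmbedding (Ω₀.domRestrict (F t))

/-- All the maps `F t`, `t ∈ [-T, T]`, are bi-Lipschitz on `U` with the constant `K`. -/
def IsBiLipschitzOn (T : ℝ) (F : ℝ → Space d → Space d) (K : ℝ≥0) (U : Set (Space d)) : Prop :=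
  ∀ t ∈ Icc (-T) T, ∀ y ∈ U, ∀ z ∈ U,
    dist (F t y) (F t z) ≤ K * dist y z ∧ dist y z ≤ K * dist (F t y) (F t z)

theorem IsBiLipschitzOn.mono {K : ℝ≥0} {U V : Set (Space d)} (h : IsBiLipschitzOn T F K V)
    (hUV : U ⊆ V) : IsBiLipschitzOn T F K U :=
  fun t ht y hy z hz => h t ht y (hUV hy) z (hUV hz)

theorem IsFlow.exists_regularSet (hF : IsFlow Ω T φ u F) :
    ∃ Ω₀, IsRegularSet Ω T F Ω₀ ∧ ∀ x ∈ Ω₀, ∃ K : ℝ≥0, ∃ U ∈ 𝓝 x, IsBiLipschitzOn T F K U := by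
  obtain ⟨Ω₀, h1, h2, h3, h4, h5⟩ := hF.regular
  refine ⟨Ω₀, ⟨h1, h2, h3, h4⟩, fun x hx => ?_⟩
  obtain ⟨K, U, hU, h⟩ := h5 x hx
  refine ⟨K.toNNReal, U, hU, fun t ht y hy z hz => ?_⟩
  have hK : K ≤ (K.toNNReal : ℝ) := Real.le_coe_toNNReal K
  have := h t ht y hy z hz
  exact ⟨this.1.trans (by gcongr), this.2.trans (by gcongr)⟩

namespace IsRegularSet

theorem continuousOn (h : IsRegularSet Ω T F Ω₀) {t : ℝ} (ht : t ∈ Icc (-T) T) :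
    ContinuousOn (F t) Ω₀ :=
  continuousOn_iff_continuous_domRestrict.2 (h.emb t ht).continuous

theorem injOn (h : IsRegularSet Ω T F Ω₀) {t : ℝ} (ht : t ∈ Icc (-T) T) : InjOn (F t) Ω₀ :=
  injOn_iff_injective.2 (h.emb t ht).injective

theorem isOpen_image (h : IsRegularSet Ω T F Ω₀) {t : ℝ} (ht : t ∈ Icc (-T) T)
    {U : Set (Space d)} (hU : IsOpen U) (hUΩ : U ⊆ Ω₀) : IsOpen (F t '' U) := by
  have := (h.emb t ht).isOpenMap _ (hU.preimage continuous_subtype_val)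
  convert this using 1
  ext y
  constructor
  · rintro ⟨x, hx, rfl⟩
    exact ⟨⟨x, hUΩ hx⟩, hx, rfl⟩
  · rintro ⟨⟨x, hx'⟩, hx, rfl⟩
    exact ⟨x, hx, rfl⟩

theorem ae_mem (h : IsRegularSet Ω T F Ω₀) (hΩ : IsOpen Ω) :
    ∀ᵐ x ∂(volume.restrict Ω), x ∈ Ω₀ := by
  rw [ae_restrict_iff' hΩ.measurableSet, ae_iff]
  convert h.null using 2
  ext x; simp

theorem restrict_eq (h : IsRegularSet Ω T F Ω₀) :
    (volume.restrict Ω₀ : Measure (Space d)) = volume.restrict Ω := by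
  refine Measure.restrict_congr_set ?_
  refine (LE.le.eventuallyLE h.subset).antisymm ?_
  exact ae_le_set.2 h.null

theorem aemeasurable (h : IsRegularSet Ω T F Ω₀) {t : ℝ} (ht : t ∈ Icc (-T) T) :
    AEMeasurable (F t) (volume.restrict Ω) := by
  rw [← h.restrict_eq]
  exact (h.continuousOn ht).aemeasurable h.isOpen.measurableSet

end IsRegularSet

/-- A flow does not charge null sets. -/
theorem IsFlow.ae_comp (hF : IsFlow Ω T φ u F) (hΩ : IsOpen Ω) {t : ℝ} (ht : t ∈ Icc (-T) T)
    {p : Space d → Prop} (hp : ∀ᵐ y ∂(volume.restrict Ω), p y) :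
    ∀ᵐ x ∂(volume.restrict Ω), p (F t x) := by
  obtain ⟨Ω₀, hreg, hbi⟩ := hF.exists_regularSet
  rw [ae_restrict_iff' hΩ.measurableSet, ae_iff] at hp
  choose! K U hU hK using hbi
  -- Bi-Lipschitz bounds are only local, so a Lindelöf argument reduces to countably many charts. In
  -- each, the lower bound controls the volume of the bad set by that of its image, which is null.
  obtain ⟨c, hc, hcc, hcov⟩ := TopologicalSpace.countable_cover_nhdsWithin
    (f := U) (s := Ω₀) (fun x hx => mem_nhdsWithin_of_mem_nhds (hU x hx))
  have key : ∀ x ∈ c, volume (U x ∩ {y | y ∈ Ω ∧ ¬ p (F t y)}) = 0 := by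
    intro x hx
    refine le_antisymm ?_ zero_le
    refine (volume_le_of_antilipschitzOn (K := K x) (f := F t) fun y hy z hz =>
      (hK x (hc hx) t ht y hy.1 z hz.1).2).trans ?_
    refine (mul_le_mul_right (measure_mono (t := {a | ¬(a ∈ Ω → p a)}) ?_) _).trans
      (by rw [hp, mul_zero])
    rintro _ ⟨y, hy, rfl⟩
    simp only [mem_ofPred_eq, Classical.not_imp]
    exact ⟨hF.mapsTo t ht hy.2.1, hy.2.2⟩
  have h2 : volume (⋃ x ∈ c, (U x ∩ {y | y ∈ Ω ∧ ¬ p (F t y)})) = 0 :=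
    (measure_biUnion_null_iff hcc).2 key
  rw [ae_restrict_iff' hΩ.measurableSet, ae_iff]
  refine measure_mono_null (t := (Ω \ Ω₀) ∪ _) ?_ (measure_union_null hreg.null h2)
  intro x hx
  simp only [mem_ofPred_eq, Classical.not_imp] at hx
  by_cases hx0 : x ∈ Ω₀
  · right
    obtain ⟨y, hy, hxy⟩ := mem_iUnion₂.1 (hcov hx0)
    exact mem_iUnion₂.2 ⟨y, hy, hxy, hx⟩
  · exact .inl ⟨hx.1, hx0⟩

theorem IsFlow.aemeasurable (hF : IsFlow Ω T φ u F) {t : ℝ} (ht : t ∈ Icc (-T) T) :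
    AEMeasurable (F t) (volume.restrict Ω) :=
  hF.exists_regularSet.choose_spec.1.aemeasurable ht

theorem IsFlow.map_absolutelyContinuous (hF : IsFlow Ω T φ u F) (hΩ : IsOpen Ω) {t : ℝ}
    (ht : t ∈ Icc (-T) T) : (volume.restrict Ω).map (F t) ≪ volume.restrict Ω := by
  refine Measure.AbsolutelyContinuous.mk fun s hs h0 => ?_
  rw [Measure.map_apply_of_aemeasurable (hF.aemeasurable ht) hs]
  exact measure_eq_zero_iff_ae_notMem.2 (hF.ae_comp hΩ ht (measure_eq_zero_iff_ae_notMem.1 h0))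

theorem IsFlow.aestronglyMeasurable_comp {β : Type*} [TopologicalSpace β]
    (hF : IsFlow Ω T φ u F) (hΩ : IsOpen Ω)
    {t : ℝ} (ht : t ∈ Icc (-T) T) {g : Space d → β}
    (hg : AEStronglyMeasurable g (volume.restrict Ω)) :
    AEStronglyMeasurable (fun x => g (F t x)) (volume.restrict Ω) :=
  (hg.mono_ac (hF.map_absolutelyContinuous hΩ ht)).comp_aemeasurable (hF.aemeasurable ht)

theorem IsFlow.ae_continuousOn (hF : IsFlow Ω T φ u F) :
    ∀ᵐ x ∂(volume.restrict Ω), ContinuousOn (fun t => F t x) (Icc (-T) T) := by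
  filter_upwards [hF.ode] with x hx
  by_cases hT : -T ≤ T
  swap
  · rw [Icc_eq_empty hT]; exact continuousOn_empty _
  have h0 : (0 : ℝ) ∈ uIcc (-T) T := by rw [uIcc_of_le hT]; constructor <;> linarith
  have := intervalIntegral.continuousOn_primitive_interval' hx.1 h0
  rw [uIcc_of_le hT] at this
  exact (this.const_add x).congr fun t ht => hx.2 t ht

theorem IsFlow.ae_zero (hF : IsFlow Ω T φ u F) (hT : 0 ≤ T) :
    ∀ᵐ x ∂(volume.restrict Ω), F 0 x = x := by
  filter_upwards [hF.ode] with x hx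
  simpa using hx.2 0 ⟨by linarith, hT⟩

theorem neg_mem_Icc_neg {t : ℝ} (ht : t ∈ Icc (-T) T) : -t ∈ Icc (-T) T :=
  ⟨by linarith [ht.2], by linarith [ht.1]⟩

theorem IsFlow.ae_comp_neg (hF : IsFlow Ω T φ u F) {t : ℝ} (ht : t ∈ Icc (-T) T) :
    ∀ᵐ x ∂(volume.restrict Ω), F t (F (-t) x) = x := by
  have hT : 0 ≤ T := by linarith [ht.1, ht.2]
  filter_upwards [hF.ae_zero hT,
    hF.group t ht (-t) (neg_mem_Icc_neg ht) ⟨by linarith, by linarith⟩] with x h1 h2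
  rw [h2, add_neg_cancel, h1]

/-- A null measurable set of a product with null sections is null. -/
theorem measure_prod_null_of_nullMeasurableSet {α β : Type*} [MeasurableSpace α]
    [MeasurableSpace β] {μ : Measure α} {ν : Measure β} [SFinite ν] {s : Set (α × β)}
    (hs : NullMeasurableSet s (μ.prod ν)) (h : ∀ᵐ x ∂μ, ν (Prod.mk x ⁻¹' s) = 0) :
    μ.prod ν s = 0 := by
  obtain ⟨t, htm, hts⟩ := hs
  have hsec : ∀ᵐ x ∂μ, ∀ᵐ y ∂ν, ((x, y) ∈ s ↔ (x, y) ∈ t) :=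
    Measure.ae_ae_of_ae_prod (hts.mono fun p hp => iff_of_eq hp)
  rw [measure_congr hts]
  refine Measure.measure_prod_null_of_ae_null htm ?_
  filter_upwards [h, hsec] with x hx hx'
  rw [Pi.zero_apply, ← hx]
  exact measure_congr (hx'.mono fun y hy => propext hy.symm)

/-- Joint measurability of a flow. -/
theorem IsFlow.aemeasurable_uncurry (hF : IsFlow Ω T φ u F) (hΩ : IsOpen Ω) (hT : 0 ≤ T) :
    AEMeasurable (fun p : ℝ × Space d => F p.1 p.2)
      ((volume.restrict (Icc (-T) T)).prod (volume.restrict Ω)) := by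
  obtain ⟨Ω₀, hreg, -⟩ := hF.exists_regularSet
  have hT' : -T ≤ T := by linarith
  obtain ⟨N, hN, hNm, hN0⟩ := exists_measurable_superset_of_null
    (ae_iff.1 ((hreg.ae_mem hΩ).and hF.ae_continuousOn))
  let A := Nᶜ
  have hA : ∀ x ∈ A, x ∈ Ω₀ ∧ ContinuousOn (fun t => F t x) (Icc (-T) T) := by
    intro x hx
    by_contra hcon
    exact hx (hN hcon)
  -- Once redefined as zero off the full-measure set `A`, the flow is continuous in `t` and
  -- measurable in `x`, hence jointly measurable.
  let G : Icc (-T) T → Space d → Space d := fun t => A.indicator (F t)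
  have hG : Measurable (Function.uncurry G) := by
    refine measurable_uncurry_of_continuous_of_measurable (fun x => ?_) (fun t => ?_)
    · by_cases hx : x ∈ A
      · simp only [G, indicator_of_mem hx]
        exact continuousOn_iff_continuous_domRestrict.1 (hA x hx).2
      · simp only [G, indicator_of_notMem hx]
        exact continuous_const
    · refine (measurable_of_restrict_of_restrict_compl hNm ?_ ?_)
      · have : N.domRestrict (G t) = fun _ => 0 := by
          ext x : 1
          exact indicator_of_notMem (not_not_intro x.2) _
        rw [this]
        exact measurable_const
      · have : Nᶜ.domRestrict (G t) = Nᶜ.domRestrict (F t) := by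
          ext x : 1
          exact indicator_of_mem x.2 _
        rw [this]
        exact (continuousOn_iff_continuous_domRestrict.1
          ((hreg.continuousOn t.2).mono fun x hx => (hA x hx).1)).measurable
  refine ⟨fun p => G (projIcc (-T) T hT' p.1) p.2,
    hG.comp (((continuous_projIcc (h := hT')).measurable.comp measurable_fst).prodMk measurable_snd), ?_⟩
  have h1 : ∀ᵐ p : ℝ × Space d ∂((volume.restrict (Icc (-T) T)).prod (volume.restrict Ω)),
      p.2 ∈ A := by
    have : ∀ᵐ x ∂(volume.restrict Ω), x ∈ A := measure_eq_zero_iff_ae_notMem.1 hN0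
    exact Measure.quasiMeasurePreserving_snd.ae this
  have h2 : ∀ᵐ p : ℝ × Space d ∂((volume.restrict (Icc (-T) T)).prod (volume.restrict Ω)),
      p.1 ∈ Icc (-T) T :=
    Measure.quasiMeasurePreserving_fst.ae (ae_restrict_mem measurableSet_Icc)
  filter_upwards [h1, h2] with p hp1 hp2
  simp only [G]
  rw [indicator_of_mem hp1, projIcc_of_mem hT' hp2]

/-- Every time slice of the preimage of a null set is null by `IsFlow.ae_comp`. The preimage is only
known to be null measurable, which is why Fubini is applied through
`measure_prod_null_of_nullMeasurableSet`. -/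
theorem IsFlow.map_uncurry_absolutelyContinuous (hF : IsFlow Ω T φ u F) (hΩ : IsOpen Ω)
    (hT : 0 ≤ T) :
    ((volume.restrict (Icc (-T) T)).prod (volume.restrict Ω)).map
      (fun p : ℝ × Space d => F p.1 p.2) ≪ volume.restrict Ω := by
  have hm := hF.aemeasurable_uncurry hΩ hT
  refine Measure.AbsolutelyContinuous.mk fun s hs h0 => ?_
  rw [Measure.map_apply_of_aemeasurable hm hs]
  refine measure_prod_null_of_nullMeasurableSet (hm.nullMeasurable hs) ?_
  filter_upwards [ae_restrict_mem measurableSet_Icc] with t ht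
  exact measure_eq_zero_iff_ae_notMem.2 (hF.ae_comp hΩ ht (measure_eq_zero_iff_ae_notMem.1 h0))

theorem IsFlow.ae_comp_uncurry (hF : IsFlow Ω T φ u F) (hΩ : IsOpen Ω) (hT : 0 ≤ T)
    {p : Space d → Prop} (hp : ∀ᵐ y ∂(volume.restrict Ω), p y) :
    ∀ᵐ q : ℝ × Space d ∂((volume.restrict (Icc (-T) T)).prod (volume.restrict Ω)),
      p (F q.1 q.2) :=
  ae_of_ae_map (hF.aemeasurable_uncurry hΩ hT)
    ((hF.map_uncurry_absolutelyContinuous hΩ hT).ae_le hp)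

theorem IsFlow.aestronglyMeasurable_comp_uncurry {β : Type*} [TopologicalSpace β]
    (hF : IsFlow Ω T φ u F) (hΩ : IsOpen Ω) (hT : 0 ≤ T) {g : Space d → β}
    (hg : AEStronglyMeasurable g (volume.restrict Ω)) :
    AEStronglyMeasurable (fun q : ℝ × Space d => g (F q.1 q.2))
      ((volume.restrict (Icc (-T) T)).prod (volume.restrict Ω)) :=
  (hg.mono_ac (hF.map_uncurry_absolutelyContinuous hΩ hT)).comp_aemeasurable
    (hF.aemeasurable_uncurry hΩ hT)

end Flow

/-! ### Transported functions and compressibility -/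

section Transport

variable {d : ℕ} {Ω Ω₀ U S : Set (Space d)} {T : ℝ} {φ : Space d → ℝ} {u : Space d → Space d}
  {F : ℝ → Space d → Space d} {K : ℝ≥0} {t : ℝ} {g : Space d → ℝ}

/-- The function `g ∘ (F t)⁻¹` on `F t '' Ω₀`, extended by zero. -/
noncomputable def transport (Ω₀ : Set (Space d)) (F : ℝ → Space d → Space d) (t : ℝ)
    (g : Space d → ℝ) : Space d → ℝ :=
  Function.extend (Ω₀.domRestrict (F t)) (fun z => g z) 0

theorem IsRegularSet.transport_apply (h : IsRegularSet Ω T F Ω₀) (ht : t ∈ Icc (-T) T)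
    (g : Space d → ℝ) {z : Space d} (hz : z ∈ Ω₀) : transport Ω₀ F t g (F t z) = g z :=
  (h.emb t ht).injective.extend_apply (fun z : Ω₀ => g z) 0 ⟨z, hz⟩

theorem IsRegularSet.transport_eq_zero (h : IsRegularSet Ω T F Ω₀) (ht : t ∈ Icc (-T) T)
    (h0 : ∀ z ∉ S, g z = 0) {x : Space d} (hx : x ∉ F t '' S) : transport Ω₀ F t g x = 0 := by
  by_cases hx' : ∃ a : Ω₀, Ω₀.domRestrict (F t) a = x
  · obtain ⟨a, rfl⟩ := hx'
    refine (h.transport_apply ht g a.2).trans (h0 _ fun ha => hx ⟨a, ha, rfl⟩)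
  · exact Function.extend_apply' _ _ _ hx'

theorem IsRegularSet.abs_transport_le (h : IsRegularSet Ω T F Ω₀) (ht : t ∈ Icc (-T) T) {M : ℝ}
    (hM : ∀ z, |g z| ≤ M) (x : Space d) : |transport Ω₀ F t g x| ≤ M := by
  by_cases hx' : ∃ a : Ω₀, Ω₀.domRestrict (F t) a = x
  · obtain ⟨a, rfl⟩ := hx'
    exact (congrArg abs (h.transport_apply ht g a.2)).trans_le (hM _)
  · rw [transport, Function.extend_apply' _ _ _ hx', Pi.zero_apply, abs_zero]
    exact (abs_nonneg _).trans (hM 0)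

/-- Almost every `x` is `F t (F (-t) x)` by the group property, and its foot `F (-t) x` is regular
because the flow does not charge the complement of `Ω₀`. -/
theorem IsFlow.transport_ae (hF : IsFlow Ω T φ u F) (hΩ : IsOpen Ω) (h : IsRegularSet Ω T F Ω₀)
    (ht : t ∈ Icc (-T) T) (g : Space d → ℝ) :
    ∀ᵐ x ∂(volume.restrict Ω), transport Ω₀ F t g x = g (F (-t) x) := by
  filter_upwards [hF.ae_comp_neg ht, hF.ae_comp hΩ (neg_mem_Icc_neg ht) (h.ae_mem hΩ)]
    with x h1 h2
  conv_lhs => rw [← h1]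
  exact h.transport_apply ht g h2

/-- The inverse of `F t` is `K`-Lipschitz on the open set `F t '' U`, a neighbourhood of the compact
set `F t '' S` off which the transported function vanishes. -/
theorem IsRegularSet.exists_lipschitzWith_transport (h : IsRegularSet Ω T F Ω₀)
    (ht : t ∈ Icc (-T) T) (hU : IsOpen U) (hUΩ : U ⊆ Ω₀) (hK : IsBiLipschitzOn T F K U)
    (hS : IsCompact S) (hSU : S ⊆ U) {L : ℝ≥0} (hg : LipschitzWith L g) {M : ℝ}
    (hM : ∀ z, |g z| ≤ M) (h0 : ∀ z ∉ S, g z = 0) :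
    ∃ L' : ℝ≥0, LipschitzWith L' (transport Ω₀ F t g) := by
  refine exists_lipschitzWith_of_lipschitzOnWith (V := F t '' U) (S := F t '' S) (L := L * K)
    (M := M) ?_ (hS.image_of_continuousOn ((h.continuousOn ht).mono (hSU.trans hUΩ)))
    (h.isOpen_image ht hU hUΩ) (image_mono hSU) (fun x hx => h.transport_eq_zero ht h0 hx)
    (h.abs_transport_le ht hM)
  refine LipschitzOnWith.of_dist_le_mul ?_
  rintro _ ⟨y, hy, rfl⟩ _ ⟨z, hz, rfl⟩
  rw [h.transport_apply ht g (hUΩ hy), h.transport_apply ht g (hUΩ hz)]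
  calc dist (g y) (g z) ≤ L * dist y z := hg.dist_le_mul y z
    _ ≤ L * (K * dist (F t y) (F t z)) := by gcongr; exact (hK t ht y hy z hz).2
    _ = _ := by push_cast; ring

theorem IsRegularSet.tsupport_transport_subset (h : IsRegularSet Ω T F Ω₀)
    (ht : t ∈ Icc (-T) T) (hS : IsCompact S) (hSΩ : S ⊆ Ω₀) (h0 : ∀ z ∉ S, g z = 0) :
    tsupport (transport Ω₀ F t g) ⊆ F t '' S := by
  refine closure_minimal ?_ (hS.image_of_continuousOn ((h.continuousOn ht).mono hSΩ)).isClosed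
  intro x hx
  by_contra hcon
  exact hx (h.transport_eq_zero ht h0 hcon)

/-- Compressibility of the flow on the images of a set on which it is bi-Lipschitz. -/
theorem IsFlow.map_restrict_le (hF : IsFlow Ω T φ u F) (hΩ : IsOpen Ω)
    (h : IsRegularSet Ω T F Ω₀) (hU : IsOpen U) (hUΩ : U ⊆ Ω₀) (hK : IsBiLipschitzOn T F K U)
    (ht : t ∈ Icc (-T) T) {s : ℝ} (hs : s ∈ Icc (-T) T) (hst : t + s ∈ Icc (-T) T) :
    ((volume.restrict Ω).map (F (-s))).restrict (F t '' U) ≤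
      ((K : ℝ≥0∞) ^ d * (K : ℝ≥0∞) ^ d) • volume.restrict Ω := by
  have hs' := neg_mem_Icc_neg hs
  have ht' := neg_mem_Icc_neg ht
  have hst' := neg_mem_Icc_neg hst
  have hVo : IsOpen (F t '' U) := h.isOpen_image ht hU hUΩ
  refine Measure.le_iff.2 fun E hE => ?_
  rw [Measure.restrict_apply hE, Measure.map_apply_of_aemeasurable (hF.aemeasurable hs')
    (hE.inter hVo.measurableSet)]
  -- Almost everywhere `F (-s) = F t ∘ F (-(t + s))`, so a point sent into `F t '' U` comes from `U`
  -- by `F (t + s)`, using injectivity of `F t`. One factor `K ^ d` then bounds the expansion by `F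
  -- (t + s)`, the other the contraction by `F t`.
  have hsub : (volume.restrict Ω) (F (-s) ⁻¹' (E ∩ F t '' U)) ≤
      (volume.restrict Ω) (F (t + s) '' (U ∩ F t ⁻¹' E)) := by
    refine measure_mono_ae ?_
    have e1 : ∀ᵐ x ∂(volume.restrict Ω), F (-t) (F (-s) x) = F (-(t + s)) x := by
      rw [neg_add]; exact hF.group _ ht' _ hs' (by rwa [← neg_add])
    filter_upwards [e1, hF.ae_comp_neg hst, hF.ae_comp hΩ hs' (hF.ae_comp_neg ht),
      hF.ae_comp hΩ hst' (h.ae_mem hΩ)] with x h1 h2 h3 h4 h5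
    have h5' : F (-s) x ∈ E ∩ F t '' U := h5
    obtain ⟨hxE, z, hz, hzx⟩ := h5'
    have hz' : z = F (-(t + s)) x := by
      refine h.injOn ht (hUΩ hz) h4 ?_
      rw [← h1, h3, hzx]
    subst hz'
    exact ⟨_, ⟨hz, by rw [mem_preimage, hzx]; exact hxE⟩, h2⟩
  refine hsub.trans ?_
  have hΩ1 : F t '' (U ∩ F t ⁻¹' E) ⊆ E ∩ Ω := by
    rintro _ ⟨z, hz, rfl⟩
    exact ⟨hz.2, hF.mapsTo t ht (h.subset (hUΩ hz.1))⟩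
  calc (volume.restrict Ω) (F (t + s) '' (U ∩ F t ⁻¹' E))
      ≤ volume (F (t + s) '' (U ∩ F t ⁻¹' E)) := Measure.restrict_apply_le _ _
    _ ≤ (K : ℝ≥0∞) ^ d * volume (U ∩ F t ⁻¹' E) :=
        volume_image_le_of_lipschitzOnWith (LipschitzOnWith.of_dist_le_mul fun y hy z hz =>
          (hK _ hst y hy.1 z hz.1).1)
    _ ≤ (K : ℝ≥0∞) ^ d * ((K : ℝ≥0∞) ^ d * volume (F t '' (U ∩ F t ⁻¹' E))) := by
        gcongr
        exact volume_le_of_antilipschitzOn fun y hy z hz => (hK _ ht y hy.1 z hz.1).2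
    _ ≤ (K : ℝ≥0∞) ^ d * ((K : ℝ≥0∞) ^ d * volume (E ∩ Ω)) := by gcongr
    _ = _ := by
        rw [Measure.smul_apply, smul_eq_mul, Measure.restrict_apply hE, mul_assoc]

theorem IsFlow.lintegral_comp_le (hF : IsFlow Ω T φ u F) (hΩ : IsOpen Ω)
    (h : IsRegularSet Ω T F Ω₀) (hU : IsOpen U) (hUΩ : U ⊆ Ω₀) (hK : IsBiLipschitzOn T F K U)
    (ht : t ∈ Icc (-T) T) {s : ℝ} (hs : s ∈ Icc (-T) T) (hst : t + s ∈ Icc (-T) T)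
    {H : Space d → ℝ≥0∞} (hH : AEMeasurable H (volume.restrict Ω))
    (h0 : ∀ x ∉ F t '' U, H x = 0) :
    ∫⁻ x in Ω, H (F (-s) x) ≤ ((K : ℝ≥0∞) ^ d * (K : ℝ≥0∞) ^ d) * ∫⁻ x in Ω, H x := by
  have hs' := neg_mem_Icc_neg hs
  calc ∫⁻ x in Ω, H (F (-s) x) = ∫⁻ y, H y ∂((volume.restrict Ω).map (F (-s))) :=
        (lintegral_map' (hH.mono_ac (hF.map_absolutelyContinuous hΩ hs'))
          (hF.aemeasurable hs')).symm
    _ = ∫⁻ y in F t '' U, H y ∂((volume.restrict Ω).map (F (-s))) := by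
        rw [← lintegral_indicator (h.isOpen_image ht hU hUΩ).measurableSet]
        refine lintegral_congr fun y => ?_
        by_cases hy : y ∈ F t '' U
        · rw [indicator_of_mem hy]
        · rw [indicator_of_notMem hy, h0 y hy]
    _ ≤ ∫⁻ y, H y ∂(((K : ℝ≥0∞) ^ d * (K : ℝ≥0∞) ^ d) • volume.restrict Ω) :=
        lintegral_mono' (hF.map_restrict_le hΩ h hU hUΩ hK ht hs hst) le_rfl
    _ = _ := lintegral_smul_measure _ _

theorem IsFlow.integrable_comp (hF : IsFlow Ω T φ u F) (hΩ : IsOpen Ω)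
    (h : IsRegularSet Ω T F Ω₀) (hU : IsOpen U) (hUΩ : U ⊆ Ω₀) (hK : IsBiLipschitzOn T F K U)
    (ht : t ∈ Icc (-T) T) {s : ℝ} (hs : s ∈ Icc (-T) T) (hst : t + s ∈ Icc (-T) T)
    {H : Space d → ℝ} (hH : IntegrableOn H Ω) (h0 : ∀ x ∉ F t '' U, H x = 0) :
    IntegrableOn (fun x => H (F (-s) x)) Ω ∧
      ∫ x in Ω, ‖H (F (-s) x)‖ ≤ ((K : ℝ) ^ d * (K : ℝ) ^ d) * ∫ x in Ω, ‖H x‖ := by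
  have hle := hF.lintegral_comp_le hΩ h hU hUΩ hK ht hs hst (H := fun x => ‖H x‖ₑ)
    hH.aestronglyMeasurable.enorm (fun x hx => by rw [h0 x hx, enorm_zero])
  have hfin : ((K : ℝ≥0∞) ^ d * (K : ℝ≥0∞) ^ d) * ∫⁻ x in Ω, ‖H x‖ₑ < ∞ :=
    ENNReal.mul_lt_top (ENNReal.mul_lt_top (by simp) (by simp)) hH.2
  have hint : IntegrableOn (fun x => H (F (-s) x)) Ω :=
    ⟨hF.aestronglyMeasurable_comp hΩ (neg_mem_Icc_neg hs) hH.aestronglyMeasurable,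
      hle.trans_lt hfin⟩
  refine ⟨hint, ?_⟩
  rw [integral_norm_eq_lintegral_enorm hint.aestronglyMeasurable,
    integral_norm_eq_lintegral_enorm hH.aestronglyMeasurable]
  refine (ENNReal.toReal_mono hfin.ne hle).trans_eq ?_
  simp [ENNReal.toReal_mul]

/-- Weak continuity in time of the composition with the flow. -/
theorem IsFlow.continuousOn_integral_comp (hF : IsFlow Ω T φ u F) (hΩ : IsOpen Ω)
    {w ρ : Space d → ℝ} (hw : Continuous w) {B : ℝ} (hB : ∀ x, |w x| ≤ B)
    (hρ : IntegrableOn ρ Ω) :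
    ContinuousOn (fun s => ∫ x in Ω, ρ x * w (F s x)) (Icc (-T) T) := by
  intro s hs
  rw [ContinuousWithinAt]
  refine tendsto_integral_filter_of_dominated_convergence (fun x => ‖ρ x‖ * B) ?_ ?_
    (hρ.norm.mul_const _) ?_
  · filter_upwards [self_mem_nhdsWithin] with r hr
    exact hρ.aestronglyMeasurable.mul
      (hF.aestronglyMeasurable_comp hΩ hr hw.aestronglyMeasurable)
  · refine .of_forall fun r => .of_forall fun x => ?_
    rw [norm_mul]
    gcongr
    exact hB _
  · filter_upwards [hF.ae_continuousOn] with x hx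
    exact Tendsto.const_mul (ρ x) ((hw.tendsto _).comp (hx s hs))

/-- Strong continuity at time zero of the composition with the flow. -/
theorem IsFlow.tendsto_integral_comp (hF : IsFlow Ω T φ u F) (hΩ : IsOpen Ω)
    (hfin : volume Ω ≠ ∞) (h : IsRegularSet Ω T F Ω₀) (hU : IsOpen U) (hUΩ : U ⊆ Ω₀)
    (hK : IsBiLipschitzOn T F K U) (ht : t ∈ Ico 0 T) (hS : IsCompact S) (hSU : S ⊆ U)
    {H ρ : Space d → ℝ} (hH : IntegrableOn H Ω) (h0 : ∀ x ∉ F t '' S, H x = 0)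
    (hρ : MemLp ρ ⊤ (volume.restrict Ω)) :
    Tendsto (fun s => ∫ x in Ω, ρ x * H (F (-s) x)) (𝓝[≥] 0) (𝓝 (∫ x in Ω, ρ x * H x)) := by
  have hT : 0 < T := ht.1.trans_lt ht.2
  have ht' : t ∈ Icc (-T) T := ⟨by linarith [ht.1], ht.2.le⟩
  have : IsFiniteMeasure (volume.restrict Ω) := ⟨by simpa using hfin.lt_top⟩
  obtain ⟨M, hM0, hM⟩ : ∃ M : ℝ, 0 ≤ M ∧ ∀ᵐ x ∂(volume.restrict Ω), ‖ρ x‖ ≤ M :=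
    ⟨_, lpNorm_nonneg, ae_le_lpNorm_exponent_top hρ⟩
  have hρ1 : IntegrableOn ρ Ω := hρ.integrable le_top
  have hmul : ∀ {E : Space d → ℝ}, IntegrableOn E Ω → IntegrableOn (fun x => ρ x * E x) Ω :=
    fun hE => hE.bdd_mul hρ.aestronglyMeasurable hM
  have hbound : ∀ {E : Space d → ℝ}, IntegrableOn E Ω →
      |∫ x in Ω, ρ x * E x| ≤ M * ∫ x in Ω, ‖E x‖ := by
    intro E hE
    rw [← integral_const_mul, ← Real.norm_eq_abs]
    refine norm_integral_le_of_norm_le (hE.norm.const_mul M) ?_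
    filter_upwards [hM] with x hx
    rw [norm_mul]
    gcongr
  set C : ℝ := (K : ℝ) ^ d * (K : ℝ) ^ d with hC
  have hC0 : 0 ≤ C := by positivity
  have hcS : IsCompact (F t '' S) :=
    hS.image_of_continuousOn ((h.continuousOn ht').mono (hSU.trans hUΩ))
  -- The cutoff makes the error `E = H - χ ψ` vanish off `F t '' U`, where alone the `L¹` bound for
  -- composition with `F (-s)` is available. Since `χ = 1` on the set carrying `H`, `E = χ (H - ψ)`
  -- is no larger than `H - ψ`.
  obtain ⟨χ, hχ1, hχ0, -, hχ⟩ := exists_continuous_one_zero_of_isCompact hcS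
    (h.isOpen_image ht' hU hUΩ).isClosed_compl
    (disjoint_compl_right_iff_subset.2 (image_mono hSU))
  rw [Metric.tendsto_nhds]
  intro ε hε
  -- The approximation error enters twice, composed with the flow (cost `M * C`) and uncomposed
  -- (cost `M`); the other half of `ε` is left for the continuous part.
  set δ := ε / (2 * (M * C + M + 1)) with hδ
  have hδ0 : 0 < δ := by positivity
  have hδM : M * (C * δ) + M * δ < ε / 2 := by
    have : (M * C + M + 1) * δ = ε / 2 := by rw [hδ]; field_simp
    nlinarith
  obtain ⟨ψ, hψc, hψ, hψcont, hψi⟩ :=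
    Integrable.exists_hasCompactSupport_integral_sub_le hH hδ0
  let w : Space d → ℝ := fun x => χ x * ψ x
  have hw : Continuous w := χ.continuous.mul hψcont
  have hwc : HasCompactSupport w := hψc.mul_left
  obtain ⟨B, hB⟩ := hwc.exists_bound_of_continuous hw
  let E : Space d → ℝ := fun x => H x - w x
  have hwi : IntegrableOn w Ω := (hw.integrable_of_hasCompactSupport hwc).integrableOn
  have hEi : IntegrableOn E Ω := hH.sub hwi
  have hE0 : ∀ x ∉ F t '' U, E x = 0 := by
    intro x hx
    have h1 : H x = 0 := h0 x fun hx' => hx (image_mono hSU hx')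
    have h2 : χ x = 0 := hχ0 hx
    simp [E, w, h1, h2]
  have hEle : ∀ x, ‖E x‖ ≤ ‖H x - ψ x‖ := by
    intro x
    have : E x = χ x * (H x - ψ x) := by
      by_cases hx : x ∈ F t '' S
      · have h1 : χ x = 1 := hχ1 hx
        simp [E, w, h1]
      · simp [E, w, h0 x hx]
    rw [this, norm_mul]
    have h1 : ‖χ x‖ ≤ 1 := by
      rw [Real.norm_of_nonneg (hχ x).1]; exact (hχ x).2
    exact mul_le_of_le_one_left (norm_nonneg _) h1
  have hEδ : ∫ x in Ω, ‖E x‖ ≤ δ :=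
    (integral_mono hEi.norm (hH.sub hψi).norm hEle).trans hψ
  have hlim : Tendsto (fun s => ∫ x in Ω, ρ x * w (F (-s) x)) (𝓝[≥] 0)
      (𝓝 (∫ x in Ω, ρ x * w x)) := by
    have hc := hF.continuousOn_integral_comp hΩ hw hB hρ1 0 ⟨by linarith, hT.le⟩
    have hneg : Tendsto (fun s : ℝ => -s) (𝓝[≥] 0) (𝓝[Icc (-T) T] 0) := by
      refine tendsto_nhdsWithin_iff.2 ⟨?_, ?_⟩
      · exact (continuous_neg.tendsto' (0 : ℝ) 0 neg_zero).mono_left nhdsWithin_le_nhds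
      · filter_upwards [Icc_mem_nhdsGE hT] with s hs
        exact ⟨by linarith [hs.2], by linarith [hs.1]⟩
    have := hc.tendsto.comp hneg
    have e : ∫ x in Ω, ρ x * w (F 0 x) = ∫ x in Ω, ρ x * w x := by
      refine integral_congr_ae ?_
      filter_upwards [hF.ae_zero hT.le] with x hx
      rw [hx]
    rw [e] at this
    exact this
  filter_upwards [(Metric.tendsto_nhds.1 hlim) (ε / 2) (by positivity),
    Icc_mem_nhdsGE (sub_pos.2 ht.2)] with s hs hs'
  have hsI : s ∈ Icc (-T) T := ⟨by linarith [hs'.1], by linarith [hs'.2, ht.1]⟩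
  have hst : t + s ∈ Icc (-T) T := ⟨by linarith [hs'.1, ht.1], by linarith [hs'.2]⟩
  obtain ⟨hEs, hEs'⟩ := hF.integrable_comp hΩ h hU hUΩ hK ht' hsI hst hEi hE0
  have hws : IntegrableOn (fun x => w (F (-s) x)) Ω :=
    Integrable.of_bound (hF.aestronglyMeasurable_comp hΩ (neg_mem_Icc_neg hsI)
      hw.aestronglyMeasurable) B (.of_forall fun x => hB _)
  have e1 : ∫ x in Ω, ρ x * H (F (-s) x) =
      (∫ x in Ω, ρ x * E (F (-s) x)) + ∫ x in Ω, ρ x * w (F (-s) x) := by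
    rw [← integral_add (hmul hEs) (hmul hws)]
    refine integral_congr_ae (.of_forall fun x => ?_)
    simp only [E]; ring
  have e2 : ∫ x in Ω, ρ x * H x = (∫ x in Ω, ρ x * E x) + ∫ x in Ω, ρ x * w x := by
    rw [← integral_add (hmul hEi) (hmul hwi)]
    refine integral_congr_ae (.of_forall fun x => ?_)
    simp only [E]; ring
  have b1 := (hbound hEs).trans
    (mul_le_mul_of_nonneg_left (hEs'.trans (mul_le_mul_of_nonneg_left hEδ hC0)) hM0)
  have b2 := (hbound hEi).trans (mul_le_mul_of_nonneg_left hEδ hM0)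
  rw [Real.dist_eq] at hs ⊢
  rw [e1, e2]
  rw [abs_lt] at hs ⊢
  rw [abs_le] at b1 b2
  constructor <;> linarith [b1.1, b1.2, b2.1, b2.2, hs.1, hs.2]

end Transport

/-! ### Mass balance for Lipschitz functions in a chart -/

section LocalBalance

variable {d : ℕ} {Ω Ω₀ U S : Set (Space d)} {T : ℝ} {φ : Space d → ℝ} {u : Space d → Space d}
  {F : ℝ → Space d → Space d} {K : ℝ≥0} {t : ℝ} {g : Space d → ℝ}

/-- Joint measurability of the composition with the backward flow. -/
theorem IsFlow.aestronglyMeasurable_comp_neg_uncurry {β : Type*} [TopologicalSpace β]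
    (hF : IsFlow Ω T φ u F) (hΩ : IsOpen Ω) (hT : 0 ≤ T) {G : Space d → β}
    (hG : AEStronglyMeasurable G (volume.restrict Ω)) {h : ℝ} (hh : h ≤ T) :
    AEStronglyMeasurable (fun q : ℝ × Space d => G (F (-q.1) q.2))
      ((volume.restrict (Ioc 0 h)).prod (volume.restrict Ω)) := by
  have h1 : MeasurePreserving (fun s : ℝ => -s) (volume.restrict (Icc (-T) T))
      (volume.restrict (Icc (-T) T)) := by
    have := (Measure.measurePreserving_neg (volume : Measure ℝ)).restrict_preimage
      (measurableSet_Icc (a := -T) (b := T))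
    simpa using this
  have h2 := h1.prod (MeasurePreserving.id (volume.restrict Ω))
  have h3 := (hF.aestronglyMeasurable_comp_uncurry hΩ hT hG).comp_quasiMeasurePreserving
    h2.quasiMeasurePreserving
  refine AEStronglyMeasurable.mono_measure h3 ?_
  have hsub : Ioc 0 h ⊆ Icc (-T) T := fun s hs => ⟨by linarith [hs.1], hs.2.trans hh⟩
  exact Measure.prod_mono (Measure.restrict_mono hsub le_rfl) le_rfl

/-- Fubini exchanges "at each time, for a.e. point" with "for a.e. point, at a.e. time". Thus almost
every trajectory meets the non-differentiability set of a Lipschitz function only for a null set of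
times. -/
theorem IsFlow.ae_ae_comp (hF : IsFlow Ω T φ u F) (hΩ : IsOpen Ω) (hT : 0 ≤ T)
    {p : Space d → Prop} (hp : ∀ᵐ y ∂(volume.restrict Ω), p y) :
    ∀ᵐ x ∂(volume.restrict Ω), ∀ᵐ s : ℝ, s ∈ Icc (-T) T → p (F s x) := by
  have h1 := (Measure.measurePreserving_swap (μ := volume.restrict Ω)
    (ν := volume.restrict (Icc (-T) T))).quasiMeasurePreserving.ae (hF.ae_comp_uncurry hΩ hT hp)
  filter_upwards [Measure.ae_ae_of_ae_prod h1] with x hx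
  exact (ae_restrict_iff' measurableSet_Icc).1 hx

/-- Along the flow, the difference of the values of a Lipschitz function is the integral of its
directional derivative. -/
theorem IsFlow.ae_integral_fderiv_eq_sub (hF : IsFlow Ω T φ u F) (hΩ : IsOpen Ω) (hT : 0 ≤ T)
    {G : Space d → ℝ} {L : ℝ≥0} (hG : LipschitzWith L G) {s : ℝ} (hs : s ∈ Icc 0 T) :
    ∀ᵐ x ∂(volume.restrict Ω),
      G (F (-s) x) - G x =
        -∫ r in (0 : ℝ)..s, fderiv ℝ G (F (-r) x) ((φ (F (-r) x))⁻¹ • u (F (-r) x)) := by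
  have hdiff : ∀ᵐ y ∂(volume.restrict Ω), DifferentiableAt ℝ G y :=
    ae_restrict_of_ae hG.ae_differentiableAt
  filter_upwards [hF.ode, hF.ae_ae_comp hΩ hT hdiff, hF.ae_zero hT] with x hx hx' hx0
  have hsub : uIcc 0 (-s) ⊆ Icc (-T) T := by
    rw [uIcc_of_ge (by linarith [hs.1])]
    exact Icc_subset_Icc (by linarith [hs.2]) hT
  have hb : IntervalIntegrable (fun s => (φ (F s x))⁻¹ • u (F s x)) volume 0 (-s) :=
    hx.1.mono_set (by rwa [uIcc_of_le (by linarith : -T ≤ T)])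
  have key := integral_fderiv_comp_eq_sub hG hb left_mem_uIcc
    (fun t ht => hx.2 t (hsub ht)) (hx'.mono fun r hr hr' => hr (hsub hr'))
  have hneg := intervalIntegral.integral_comp_neg (a := 0) (b := s)
    (fun r => fderiv ℝ G (F r x) ((φ (F r x))⁻¹ • u (F r x)))
  rw [neg_zero] at hneg
  rw [hneg, ← intervalIntegral.integral_symm, key, hx0]

/-- The data of a local chart of regular points, of a porosity, and of a velocity with an integrable
divergence. -/
structure LocalData (Ω Ω₀ U S : Set (Space d)) (T : ℝ) (φ : Space d → ℝ) (u : Space d → Space d)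
    (D : Space d → ℝ) (F : ℝ → Space d → Space d) (K : ℝ≥0) (φmin : ℝ) : Prop where
  flow : IsFlow Ω T φ u F
  isOpen : IsOpen Ω
  finite : volume Ω ≠ ∞
  reg : IsRegularSet Ω T F Ω₀
  isOpen_chart : IsOpen U
  chart_subset : U ⊆ Ω₀
  bilip : IsBiLipschitzOn T F K U
  compact : IsCompact S
  subset : S ⊆ U
  porosity : MemLp φ ⊤ (volume.restrict Ω)
  pos : 0 < φmin
  le_porosity : ∀ᵐ x ∂(volume.restrict Ω), φmin ≤ φ x
  velocity : IntegrableOn u Ω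
  divergence : IntegrableOn D Ω
  weakDiv : IsWeakDiv Ω u D

variable {D : Space d → ℝ} {φmin : ℝ}

/-- The directional derivative `∇G · u / φ` of a Lipschitz function is integrable. -/
theorem LocalData.integrable_deriv (hd : LocalData Ω Ω₀ U S T φ u D F K φmin)
    {G : Space d → ℝ} {L : ℝ≥0} (hG : LipschitzWith L G) :
    IntegrableOn (fun y => fderiv ℝ G y ((φ y)⁻¹ • u y)) Ω := by
  have hb : IntegrableOn (fun y => (φ y)⁻¹ • u y) Ω := by
    refine hd.velocity.bdd_smul (φmin⁻¹)
      hd.porosity.aestronglyMeasurable.aemeasurable.inv.aestronglyMeasurable ?_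
    filter_upwards [hd.le_porosity] with x hx
    rw [Pi.inv_apply, norm_inv, Real.norm_of_nonneg (hd.pos.le.trans hx)]
    exact inv_anti₀ hd.pos hx
  refine (hb.norm.const_mul (L : ℝ)).mono' ?_ (.of_forall fun y => ?_)
  · exact (ContinuousLinearMap.apply ℝ ℝ : Space d →L[ℝ] _).flip.aestronglyMeasurable_comp₂
        (measurable_fderiv ℝ G).aestronglyMeasurable hb.aestronglyMeasurable
  · exact ((fderiv ℝ G y).le_opNorm _).trans
      (by gcongr; exact norm_fderiv_le_of_lipschitz ℝ hG)

/-- Integrated form of the transport equation, in time and space. -/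
theorem LocalData.integral_sub_eq (hd : LocalData Ω Ω₀ U S T φ u D F K φmin) (ht : t ∈ Ico 0 T)
    {G : Space d → ℝ} {L : ℝ≥0} (hG : LipschitzWith L G) (hGS : tsupport G ⊆ F t '' S) {s : ℝ}
    (hs : s ∈ Icc 0 (T - t)) :
    (∫ x in Ω, φ x * G (F (-s) x)) - ∫ x in Ω, φ x * G x =
      -∫ r in (0 : ℝ)..s, ∫ x in Ω,
        φ x * fderiv ℝ G (F (-r) x) ((φ (F (-r) x))⁻¹ • u (F (-r) x)) := by
  have hF := hd.flow
  have hΩ := hd.isOpen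
  have hT : 0 ≤ T := ht.1.trans ht.2.le
  have ht' : t ∈ Icc (-T) T := ⟨by linarith [ht.1], ht.2.le⟩
  have hs' : s ∈ Icc 0 T := ⟨hs.1, by linarith [hs.2, ht.1]⟩
  have : IsFiniteMeasure (volume.restrict Ω) := ⟨by simpa using hd.finite.lt_top⟩
  set H : Space d → ℝ := fun y => fderiv ℝ G y ((φ y)⁻¹ • u y)
  have hHi : IntegrableOn H Ω := hd.integrable_deriv hG
  have hH0 : ∀ x ∉ F t '' U, H x = 0 := by
    intro x hx
    have hx' : x ∉ tsupport G := fun h => hx (image_mono hd.subset (hGS h))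
    simp [H, fderiv_of_notMem_tsupport ℝ hx']
  have hGc : HasCompactSupport G :=
    (hd.compact.image_of_continuousOn ((hd.reg.continuousOn ht').mono
      (hd.subset.trans hd.chart_subset))).of_isClosed_subset (isClosed_tsupport G) hGS
  obtain ⟨B, hB⟩ := hGc.exists_bound_of_continuous hG.continuous
  have hM := ae_le_lpNorm_exponent_top hd.porosity
  set M := lpNorm φ ⊤ (volume.restrict Ω)
  have hM0 : 0 ≤ M := lpNorm_nonneg
  have hmeas : AEStronglyMeasurable (fun q : ℝ × Space d => φ q.2 * H (F (-q.1) q.2))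
      ((volume.restrict (Ioc 0 s)).prod (volume.restrict Ω)) :=
    (hd.porosity.aestronglyMeasurable.comp_snd).mul
      (hF.aestronglyMeasurable_comp_neg_uncurry hΩ hT hHi.aestronglyMeasurable hs'.2)
  -- As `u` is unbounded, `H` is only integrable. The compressibility bound, uniform in `r` because
  -- `t + r ≤ T`, provides the joint integrability needed for Fubini.
  have hslice : ∀ r ∈ Ioc 0 s, IntegrableOn (fun x => φ x * H (F (-r) x)) Ω ∧
      ∫ x in Ω, ‖φ x * H (F (-r) x)‖ ≤
        M * (((K : ℝ) ^ d * (K : ℝ) ^ d) * ∫ x in Ω, ‖H x‖) := by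
    intro r hr
    obtain ⟨h1, h2⟩ := hF.integrable_comp hΩ hd.reg hd.isOpen_chart hd.chart_subset hd.bilip ht'
      (s := r) ⟨by linarith [hr.1], by linarith [hr.2, hs'.2]⟩
      ⟨by linarith [hr.1, ht.1], by linarith [hr.2, hs.2]⟩ hHi hH0
    have h3 := h1.bdd_mul hd.porosity.aestronglyMeasurable hM
    refine ⟨h3, le_trans ?_ (mul_le_mul_of_nonneg_left h2 hM0)⟩
    rw [← integral_const_mul]
    refine integral_mono_ae h3.norm (h1.norm.const_mul M) ?_
    filter_upwards [hM] with x hx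
    rw [norm_mul]
    gcongr
  have hint : Integrable (fun q : ℝ × Space d => φ q.2 * H (F (-q.1) q.2))
      ((volume.restrict (Ioc 0 s)).prod (volume.restrict Ω)) := by
    rw [integrable_prod_iff hmeas]
    constructor
    · filter_upwards [ae_restrict_mem measurableSet_Ioc] with r hr using (hslice r hr).1
    · refine Integrable.of_bound hmeas.norm.integral_prod_right'
        (M * (((K : ℝ) ^ d * (K : ℝ) ^ d) * ∫ x in Ω, ‖H x‖)) ?_
      · filter_upwards [ae_restrict_mem measurableSet_Ioc] with r hr
        rw [Real.norm_of_nonneg (integral_nonneg fun x => norm_nonneg _)]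
        exact (hslice r hr).2
  have hi1 : IntegrableOn (fun x => φ x * G (F (-s) x)) Ω :=
    (Integrable.of_bound (hF.aestronglyMeasurable_comp hΩ
      (neg_mem_Icc_neg ⟨by linarith [hs'.1], hs'.2⟩)
      hG.continuous.aestronglyMeasurable) B (.of_forall fun x => hB _)).bdd_mul
      hd.porosity.aestronglyMeasurable hM
  have hi2 : IntegrableOn (fun x => φ x * G x) Ω :=
    (Integrable.of_bound hG.continuous.aestronglyMeasurable B (.of_forall fun x => hB _)).bdd_mul
      hd.porosity.aestronglyMeasurable hM
  rw [← integral_sub hi1 hi2, intervalIntegral.integral_of_le hs.1, integral_integral_swap hint,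
    ← integral_neg]
  refine integral_congr_ae ?_
  filter_upwards [hF.ae_integral_fderiv_eq_sub hΩ hT hG hs'] with x hx
  rw [← mul_sub, hx, integral_const_mul, intervalIntegral.integral_of_le hs.1, mul_neg]

/-- Time derivative of the mass of a transported Lipschitz function. -/
theorem LocalData.hasDerivWithinAt (hd : LocalData Ω Ω₀ U S T φ u D F K φmin) (ht : t ∈ Ico 0 T)
    {L : ℝ≥0} (hg : LipschitzWith L g) {M : ℝ} (hM : ∀ z, |g z| ≤ M) (h0 : ∀ z ∉ S, g z = 0) :
    HasDerivWithinAt (fun s => ∫ x in Ω, φ x * g (F (-s) x)) (∫ x in Ω, D x * g (F (-t) x))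
      (Ioi t) t := by
  have hF := hd.flow
  have hΩ := hd.isOpen
  have hT : 0 ≤ T := ht.1.trans ht.2.le
  have ht' : t ∈ Icc (-T) T := ⟨by linarith [ht.1], ht.2.le⟩
  have hSΩ := hd.subset.trans hd.chart_subset
  obtain ⟨L', hG⟩ := hd.reg.exists_lipschitzWith_transport ht' hd.isOpen_chart hd.chart_subset
    hd.bilip hd.compact hd.subset hg hM h0
  have hGS := hd.reg.tsupport_transport_subset ht' hd.compact hSΩ h0
  have hGae := hF.transport_ae hΩ hd.reg ht' g
  set G := transport Ω₀ F t g
  have hcS : IsCompact (F t '' S) :=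
    hd.compact.image_of_continuousOn ((hd.reg.continuousOn ht').mono hSΩ)
  have hGc : HasCompactSupport G := hcS.of_isClosed_subset (isClosed_tsupport G) hGS
  have hGΩ : tsupport G ⊆ Ω := by
    refine hGS.trans ?_
    rintro _ ⟨z, hz, rfl⟩
    exact hF.mapsTo t ht' (hd.reg.subset (hSΩ hz))
  set H : Space d → ℝ := fun y => fderiv ℝ G y ((φ y)⁻¹ • u y)
  have hHi : IntegrableOn H Ω := hd.integrable_deriv hG
  have hH0 : ∀ x ∉ F t '' S, H x = 0 := by
    intro x hx
    have hx' : x ∉ tsupport G := fun h => hx (hGS h)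
    simp [H, fderiv_of_notMem_tsupport ℝ hx']
  -- With time restarted at `t`, the mass is that of `G` minus a primitive of `P`, so right
  -- continuity of `P` at 0 gives the right derivative `-P 0`. There `φ` cancels and the weak
  -- divergence can be tested with `G`.
  let P : ℝ → ℝ := fun s => ∫ x in Ω, φ x * H (F (-s) x)
  have hP0 : P 0 = ∫ x in Ω, φ x * H x := by
    refine integral_congr_ae ?_
    filter_upwards [hF.ae_zero hT] with x hx
    rw [neg_zero, hx]
  have hPlim : ContinuousWithinAt P (Ici 0) 0 := by
    rw [ContinuousWithinAt, hP0]
    exact hF.tendsto_integral_comp hΩ hd.finite hd.reg hd.isOpen_chart hd.chart_subset hd.bilip ht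
      hd.compact hd.subset hHi hH0 hd.porosity
  have hPval : -P 0 = ∫ x in Ω, D x * g (F (-t) x) := by
    have e1 : ∫ x in Ω, φ x * H x = ∫ x in Ω, fderiv ℝ G x (u x) := by
      refine integral_congr_ae ?_
      filter_upwards [hd.le_porosity] with x hx
      have : φ x ≠ 0 := (hd.pos.trans_le hx).ne'
      simp only [H, map_smul, smul_eq_mul]
      field_simp
    rw [hP0, e1, hd.weakDiv.integral_fderiv_lipschitz hΩ hd.velocity hd.divergence hG hGc hGΩ,
      neg_neg]
    refine integral_congr_ae ?_
    filter_upwards [hGae] with x hx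
    rw [hx, mul_comm]
  have hQ : HasDerivWithinAt (fun s => ∫ r in (0 : ℝ)..s, P r) (P 0) (Ici 0) 0 := by
    refine intervalIntegral.integral_hasDerivWithinAt_right (t := Ioi 0)
      IntervalIntegrable.refl ?_ (hPlim.mono Ioi_subset_Ici_self)
    refine ⟨Ioc 0 T, Ioc_mem_nhdsGT (ht.1.trans_lt ht.2), ?_⟩
    exact ((hd.porosity.aestronglyMeasurable.comp_snd).mul
      (hF.aestronglyMeasurable_comp_neg_uncurry hΩ hT hHi.aestronglyMeasurable
        le_rfl)).integral_prod_right'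
  have hQ' : HasDerivWithinAt (fun s => (∫ x in Ω, φ x * G x) - ∫ r in (0 : ℝ)..(s - t), P r)
      (-P 0) (Ioi t) t := by
    have hsh : HasDerivWithinAt (fun s : ℝ => s - t) 1 (Ioi t) t :=
      (hasDerivWithinAt_id t _).sub_const t
    have hQ0 : HasDerivWithinAt (fun s => ∫ r in (0 : ℝ)..s, P r) (P 0) (Ici 0) (t - t) := by
      rwa [sub_self]
    have := HasDerivWithinAt.comp (h := fun s : ℝ => s - t) t hQ0 hsh
      fun s hs => mem_Ici.2 (sub_nonneg.2 (le_of_lt hs))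
    rw [mul_one] at this
    exact this.const_sub _
  rw [hPval] at hQ'
  have heq : ∀ s ∈ Icc t T, ∫ x in Ω, φ x * g (F (-s) x) =
      (∫ x in Ω, φ x * G x) - ∫ r in (0 : ℝ)..(s - t), P r := by
    intro s hs
    have hst : s - t ∈ Icc (-T) T := ⟨by linarith [hs.1], by linarith [hs.2, ht.1]⟩
    have hs1 : -s ∈ Icc (-T) T := ⟨by linarith [hs.2], by linarith [hs.1, ht.1]⟩
    have e1 : ∫ x in Ω, φ x * g (F (-s) x) = ∫ x in Ω, φ x * G (F (-(s - t)) x) := by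
      refine integral_congr_ae ?_
      have hgr := hF.group (-t) (neg_mem_Icc_neg ht') (-(s - t)) (neg_mem_Icc_neg hst)
        (by convert hs1 using 1; ring)
      filter_upwards [hgr, hF.ae_comp hΩ (neg_mem_Icc_neg hst) hGae] with x h1 h2
      rw [h2, h1]
      congr 3
      ring
    have := hd.integral_sub_eq ht hG hGS (s := s - t) ⟨by linarith [hs.1], by linarith [hs.2]⟩
    rw [e1]
    simp only [P, H]
    linarith
  refine hQ'.congr_of_eventuallyEq ?_ (heq t ⟨le_rfl, ht.2.le⟩)
  filter_upwards [Ioc_mem_nhdsGT ht.2] with s hs using heq s ⟨hs.1.le, hs.2⟩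

/-- Balance of the mass of a transported Lipschitz function. -/
theorem LocalData.integral_balance (hd : LocalData Ω Ω₀ U S T φ u D F K φmin) {τ : ℝ}
    (hτ : τ ∈ Icc 0 T)
    {L : ℝ≥0} (hg : LipschitzWith L g) {M : ℝ} (hM : ∀ z, |g z| ≤ M) (h0 : ∀ z ∉ S, g z = 0) :
    ∫ t in (0 : ℝ)..τ, ∫ x in Ω, D x * g (F (-t) x) =
      (∫ x in Ω, φ x * g (F (-τ) x)) - ∫ x in Ω, φ x * g x := by
  have hF := hd.flow
  have hΩ := hd.isOpen
  have hT : 0 ≤ T := hτ.1.trans hτ.2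
  have : IsFiniteMeasure (volume.restrict Ω) := ⟨by simpa using hd.finite.lt_top⟩
  have hcont : ∀ {ρ : Space d → ℝ}, IntegrableOn ρ Ω →
      ContinuousOn (fun t => ∫ x in Ω, ρ x * g (F (-t) x)) (uIcc 0 τ) := by
    intro ρ hρ
    refine (hF.continuousOn_integral_comp hΩ hg.continuous hM hρ).comp continuousOn_neg ?_
    intro t ht
    rw [uIcc_of_le hτ.1] at ht
    exact neg_mem_Icc_neg ⟨by linarith [ht.1], ht.2.trans hτ.2⟩
  -- For a continuous function, a right derivative at interior times and its integrability suffice;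
  -- here this derivative is itself continuous.
  have h := intervalIntegral.integral_eq_sub_of_hasDeriv_right
    (hcont (hd.porosity.integrable le_top)) (f' := fun t => ∫ x in Ω, D x * g (F (-t) x))
    (fun t ht => ?_) (hcont hd.divergence).intervalIntegrable
  · rw [h]
    congr 1
    refine integral_congr_ae ?_
    filter_upwards [hF.ae_zero hT] with x hx
    rw [neg_zero, hx]
  · rw [min_eq_left hτ.1, max_eq_right hτ.1] at ht
    exact hd.hasDerivWithinAt ⟨ht.1.le, ht.2.trans_le hτ.2⟩ hg hM h0

end LocalBalance

/-! ### Push-forwards of measures with density -/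

section PushDensity

variable {α β : Type*} [MeasurableSpace α] [MeasurableSpace β] {μ : Measure α} {ν : Measure β}
  {f : α → β} {ρ : α → ℝ} {v : β → ℝ}

/-- The image under `f` of the measure with density `max ρ 0`. -/
noncomputable def pushDensity (μ : Measure α) (f : α → β) (ρ : α → ℝ) : Measure β :=
  (μ.withDensity fun a => ((ρ a).toNNReal : ℝ≥0∞)).map f

theorem isFiniteMeasure_pushDensity (hρ : Integrable ρ μ) :
    IsFiniteMeasure (pushDensity μ f ρ) := by
  have : IsFiniteMeasure (μ.withDensity fun a => ((ρ a).toNNReal : ℝ≥0∞)) :=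
    isFiniteMeasure_withDensity_ofReal hρ.2
  exact Measure.isFiniteMeasure_map _ _

theorem pushDensity_absolutelyContinuous (hf : AEMeasurable f μ) (hac : μ.map f ≪ ν) :
    pushDensity μ f ρ ≪ ν := by
  refine Measure.AbsolutelyContinuous.mk fun s hs h0 => ?_
  rw [pushDensity, Measure.map_apply_of_aemeasurable
    (hf.mono_ac (withDensity_absolutelyContinuous _ _)) hs]
  have := hac h0
  rw [Measure.map_apply_of_aemeasurable hf hs] at this
  exact withDensity_absolutelyContinuous _ _ this

theorem integral_pushDensity (hf : AEMeasurable f μ) (hac : μ.map f ≪ ν) (hρ : AEMeasurable ρ μ)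
    (hv : AEStronglyMeasurable v ν) :
    ∫ y, v y ∂(pushDensity μ f ρ) = ∫ a, max (ρ a) 0 * v (f a) ∂μ := by
  rw [pushDensity, integral_map (hf.mono_ac (withDensity_absolutelyContinuous _ _))
    (hv.mono_ac (pushDensity_absolutelyContinuous hf hac)),
    integral_withDensity_eq_integral_smul₀ hρ.real_toNNReal]
  simp [NNReal.smul_def]

end PushDensity

/-! ### Measures determined by Lipschitz functions -/

section MeasureExt

variable {E : Type*} [PseudoMetricSpace E] [MeasurableSpace E] [BorelSpace E]

/-- The measure of an open set is determined by the integrals of the bounded Lipschitz functions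
that vanish off this set. -/
theorem measure_isOpen_eq_of_forall_lipschitz {m m' : Measure E} [IsFiniteMeasure m]
    [IsFiniteMeasure m'] {W : Set E} (hW : IsOpen W)
    (h : ∀ (g : E → ℝ) (L : ℝ≥0), LipschitzWith L g → (∀ x, |g x| ≤ 1) → (∀ x ∉ W, g x = 0) →
      ∫ x, g x ∂m = ∫ x, g x ∂m') :
    m W = m' W := by
  let δ : ℕ → ℝ := fun n => 1 / ((n : ℝ) + 1)
  have hδ : ∀ n, 0 < δ n := fun n => by positivity
  -- These Lipschitz functions vanish off `W` and converge to its indicator, because the complement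
  -- of `W` is closed.
  let g : ℕ → E → ℝ := fun n x => 1 - (thickenedIndicator (hδ n) Wᶜ x : ℝ)
  have hb : ∀ n x, 0 ≤ g n x ∧ g n x ≤ 1 := by
    intro n x
    have h1 : (thickenedIndicator (hδ n) Wᶜ x : ℝ) ≤ 1 := by
      exact_mod_cast thickenedIndicator_le_one (hδ n) Wᶜ x
    have h2 : 0 ≤ (thickenedIndicator (hδ n) Wᶜ x : ℝ) := NNReal.coe_nonneg _
    exact ⟨by simp only [g]; linarith, by simp only [g]; linarith⟩
  have hlip : ∀ n, LipschitzWith (δ n).toNNReal⁻¹ (g n) := by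
    intro n
    have h1 := lipschitzWith_thickenedIndicator (hδ n) Wᶜ
    refine LipschitzWith.of_dist_le_mul fun x y => ?_
    have := h1.dist_le_mul x y
    rw [NNReal.dist_eq] at this
    simp only [g, Real.dist_eq]
    rw [show ∀ a b : ℝ, 1 - a - (1 - b) = -(a - b) by intros; ring, abs_neg]
    exact this
  have hz : ∀ n, ∀ x ∉ W, g n x = 0 := by
    intro n x hx
    change 1 - (thickenedIndicator (hδ n) Wᶜ x : ℝ) = 0
    rw [thickenedIndicator_one (hδ n) Wᶜ hx, NNReal.coe_one, sub_self]
  have hlim : ∀ x, Tendsto (fun n => g n x) atTop (𝓝 (W.indicator 1 x)) := by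
    intro x
    have h1 := thickenedIndicator_tendsto_indicator_closure hδ
      tendsto_one_div_add_atTop_nhds_zero_nat Wᶜ
    rw [hW.isClosed_compl.closure_eq, tendsto_pi_nhds] at h1
    have h2 := ((NNReal.continuous_coe.tendsto _).comp (h1 x)).const_sub (1 : ℝ)
    have h3 : 1 - ((Wᶜ.indicator (fun _ => (1 : ℝ≥0)) x : ℝ≥0) : ℝ) =
        W.indicator (1 : E → ℝ) x := by
      by_cases hx : x ∈ W
      · rw [indicator_of_notMem (not_not_intro hx), indicator_of_mem hx]; simp
      · rw [indicator_of_mem (mem_compl hx), indicator_of_notMem hx]; simp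
    rw [← h3]
    exact h2
  have key : ∀ m : Measure E, IsFiniteMeasure m →
      Tendsto (fun n => ∫ x, g n x ∂m) atTop (𝓝 (m.real W)) := by
    intro m hm
    rw [← integral_indicator_one hW.measurableSet]
    refine tendsto_integral_of_dominated_convergence (fun _ => 1)
      (fun n => (hlip n).continuous.aestronglyMeasurable) (integrable_const _)
      (fun n => .of_forall fun x => ?_) (.of_forall hlim)
    rw [Real.norm_of_nonneg (hb n x).1]
    exact (hb n x).2
  have heq : m.real W = m'.real W := by
    refine tendsto_nhds_unique (key m inferInstance) ((key m' inferInstance).congr fun n => ?_)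
    exact (h (g n) _ (hlip n) (fun x => by rw [abs_of_nonneg (hb n x).1]; exact (hb n x).2)
      (hz n)).symm
  exact (measureReal_eq_measureReal_iff).1 heq

/-- Two finite measures with the same integrals of bounded Lipschitz functions vanishing off an open
set coincide on this set. -/
theorem restrict_eq_of_forall_lipschitz {m m' : Measure E} [IsFiniteMeasure m]
    [IsFiniteMeasure m'] {B : Set E} (hB : IsOpen B)
    (h : ∀ (g : E → ℝ) (L : ℝ≥0), LipschitzWith L g → (∀ x, |g x| ≤ 1) → (∀ x ∉ B, g x = 0) →
      ∫ x, g x ∂m = ∫ x, g x ∂m') :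
    m.restrict B = m'.restrict B := by
  have key : ∀ V, IsOpen V → m.restrict B V = m'.restrict B V := by
    intro V hV
    rw [Measure.restrict_apply hV.measurableSet, Measure.restrict_apply hV.measurableSet]
    exact measure_isOpen_eq_of_forall_lipschitz (hV.inter hB) fun g L hg h1 h0 =>
      h g L hg h1 fun x hx => h0 x fun hx' => hx hx'.2
  exact ext_of_generate_finite _ (BorelSpace.measurable_eq (α := E)) isPiSystem_isOpen
    (fun s hs => key s hs) (key _ isOpen_univ)

end MeasureExt

/-! ### Mass balance for bounded functions -/

section GlobalBalance

variable {d : ℕ} {Ω : Set (Space d)} {T : ℝ} {φ : Space d → ℝ} {u : Space d → Space d}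
  {F : ℝ → Space d → Space d} {D : Space d → ℝ} {v : Space d → ℝ}

theorem IsFlow.aemeasurable_neg_uncurry (hF : IsFlow Ω T φ u F) (hΩ : IsOpen Ω) (hT : 0 ≤ T)
    {h : ℝ} (hh : h ≤ T) :
    AEMeasurable (fun q : ℝ × Space d => F (-q.1) q.2)
      ((volume.restrict (Ioc 0 h)).prod (volume.restrict Ω)) :=
  (hF.aestronglyMeasurable_comp_neg_uncurry hΩ hT
    (aestronglyMeasurable_id (α := Space d)) hh).aemeasurable

theorem IsFlow.map_neg_uncurry_absolutelyContinuous (hF : IsFlow Ω T φ u F) (hΩ : IsOpen Ω)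
    (hT : 0 ≤ T) {h : ℝ} (hh : h ≤ T) :
    ((volume.restrict (Ioc 0 h)).prod (volume.restrict Ω)).map
      (fun q : ℝ × Space d => F (-q.1) q.2) ≪ volume.restrict Ω := by
  have hm := hF.aemeasurable_neg_uncurry hΩ hT hh
  refine Measure.AbsolutelyContinuous.mk fun s hs h0 => ?_
  rw [Measure.map_apply_of_aemeasurable hm hs]
  refine measure_prod_null_of_nullMeasurableSet (hm.nullMeasurable hs) ?_
  filter_upwards [ae_restrict_mem measurableSet_Ioc] with t ht
  exact measure_eq_zero_iff_ae_notMem.2 (hF.ae_comp hΩ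
    (neg_mem_Icc_neg ⟨by linarith [ht.1], ht.2.trans hh⟩) (measure_eq_zero_iff_ae_notMem.1 h0))

/-- The composition of a bounded function with the backward flow, multiplied by an integrable
function, is integrable in time and space. -/
theorem IsFlow.integrable_mul_comp_neg (hF : IsFlow Ω T φ u F) (hΩ : IsOpen Ω) (hT : 0 ≤ T)
    {h : ℝ} (hh : h ≤ T) (hD : IntegrableOn D Ω) (hv : MemLp v ⊤ (volume.restrict Ω)) :
    Integrable (fun q : ℝ × Space d => D q.2 * v (F (-q.1) q.2))
      ((volume.restrict (Ioc 0 h)).prod (volume.restrict Ω)) := by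
  refine Integrable.mul_bdd (c := lpNorm v ⊤ (volume.restrict Ω)) (hD.comp_snd _)
    (hF.aestronglyMeasurable_comp_neg_uncurry hΩ hT hv.aestronglyMeasurable hh) ?_
  exact ae_of_ae_map (hF.aemeasurable_neg_uncurry hΩ hT hh)
    ((hF.map_neg_uncurry_absolutelyContinuous hΩ hT hh).ae_le (ae_le_lpNorm_exponent_top hv))

/-- Balance of the mass of a bounded function transported by the flow. -/
theorem IsFlow.integral_balance (hF : IsFlow Ω T φ u F) (hΩ : IsOpen Ω) (hfin : volume Ω ≠ ∞)
    (hφ : MemLp φ ⊤ (volume.restrict Ω)) {φmin : ℝ} (hφmin : 0 < φmin)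
    (hφpos : ∀ᵐ x ∂(volume.restrict Ω), φmin ≤ φ x) (hu : IntegrableOn u Ω)
    (hD : IntegrableOn D Ω) (hdiv : IsWeakDiv Ω u D) {τ : ℝ} (hτ : τ ∈ Icc 0 T)
    (hv : MemLp v ⊤ (volume.restrict Ω)) :
    ∫ t in (0 : ℝ)..τ, ∫ x in Ω, D x * v (F (-t) x) =
      (∫ x in Ω, φ x * v (F (-τ) x)) - ∫ x in Ω, φ x * v x := by
  have hT : 0 ≤ T := hτ.1.trans hτ.2
  have : IsFiniteMeasure (volume.restrict Ω) := ⟨by simpa using hfin.lt_top⟩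
  have hτ' : -τ ∈ Icc (-T) T := neg_mem_Icc_neg ⟨by linarith [hτ.1], hτ.2⟩
  set μ : Measure (Space d) := volume.restrict Ω with hμ
  set κ := (volume.restrict (Ioc 0 τ)).prod μ with hκ
  have hφi : Integrable φ μ := hφ.integrable le_top
  have hDi : Integrable (fun q : ℝ × Space d => D q.2) κ := hD.comp_snd _
  have hDi' : Integrable (fun q : ℝ × Space d => -D q.2) κ := hDi.neg
  let Φ : ℝ × Space d → Space d := fun q => F (-q.1) q.2
  have hΦ : AEMeasurable Φ κ := hF.aemeasurable_neg_uncurry hΩ hT hτ.2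
  have hΦac : κ.map Φ ≪ μ := hF.map_neg_uncurry_absolutelyContinuous hΩ hT hτ.2
  have hFm := hF.aemeasurable hτ'
  have hFac := hF.map_absolutelyContinuous hΩ hτ'
  have hid : μ.map id ≪ μ := by rw [Measure.map_id]
  -- The divergence has no sign. Putting its negative part beside the final mass and its positive
  -- part beside the initial mass makes the balance an equality `m1 + nm = m0 + np` of positive
  -- measures.
  let m1 := pushDensity μ (F (-τ)) φ
  let m0 := pushDensity μ id φ
  let np := pushDensity κ Φ fun q => D q.2
  let nm := pushDensity κ Φ fun q => -D q.2
  have hm1 : m1 ≪ μ := pushDensity_absolutelyContinuous hFm hFac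
  have hm0 : m0 ≪ μ := pushDensity_absolutelyContinuous aemeasurable_id hid
  have hnp : np ≪ μ := pushDensity_absolutelyContinuous hΦ hΦac
  have hnm : nm ≪ μ := pushDensity_absolutelyContinuous hΦ hΦac
  have f1 : IsFiniteMeasure m1 := isFiniteMeasure_pushDensity hφi
  have f0 : IsFiniteMeasure m0 := isFiniteMeasure_pushDensity hφi
  have fp : IsFiniteMeasure np := isFiniteMeasure_pushDensity hDi
  have fm : IsFiniteMeasure nm := isFiniteMeasure_pushDensity hDi'
  have hint : ∀ {m : Measure (Space d)} {v : Space d → ℝ}, m ≪ μ → IsFiniteMeasure m →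
      MemLp v ⊤ μ → Integrable v m := fun hm _ hv =>
    Integrable.of_bound (hv.aestronglyMeasurable.mono_ac hm) _
      (hm.ae_le (ae_le_lpNorm_exponent_top hv))
  have hmax : ∀ {w : Space d → ℝ}, ∫ x, max (φ x) 0 * w x ∂μ = ∫ x, φ x * w x ∂μ := by
    intro w
    refine integral_congr_ae ?_
    filter_upwards [hφpos] with x hx
    rw [max_eq_left (hφmin.le.trans hx)]
  have key : ∀ {v : Space d → ℝ}, MemLp v ⊤ μ →
      (∫ x, v x ∂(m1 + nm)) - ∫ x, v x ∂(m0 + np) =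
        (∫ x in Ω, φ x * v (F (-τ) x)) - (∫ x in Ω, φ x * v x) -
          ∫ t in (0 : ℝ)..τ, ∫ x in Ω, D x * v (F (-t) x) := by
    intro v hv
    have hvm := hv.aestronglyMeasurable
    have hpp := hF.integrable_mul_comp_neg hΩ hT hτ.2 hD.pos_part hv
    have hpm := hF.integrable_mul_comp_neg hΩ hT hτ.2 hD.neg_part hv
    have e : (∫ q, max (D q.2) 0 * v (Φ q) ∂κ) - ∫ q, max (-D q.2) 0 * v (Φ q) ∂κ =
        ∫ t in (0 : ℝ)..τ, ∫ x in Ω, D x * v (F (-t) x) := by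
      rw [intervalIntegral.integral_of_le hτ.1,
        integral_integral (hF.integrable_mul_comp_neg hΩ hT hτ.2 hD hv), ← integral_sub hpp hpm]
      refine integral_congr_ae (.of_forall fun q => ?_)
      simp only
      rw [← sub_mul, max_zero_sub_max_neg_zero_eq_self]
    rw [integral_add_measure (hint hm1 f1 hv) (hint hnm fm hv),
      integral_add_measure (hint hm0 f0 hv) (hint hnp fp hv),
      integral_pushDensity hFm hFac hφi.aemeasurable hvm,
      integral_pushDensity aemeasurable_id hid hφi.aemeasurable hvm,
      integral_pushDensity hΦ hΦac hDi.aemeasurable hvm,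
      integral_pushDensity hΦ hΦac hDi'.aemeasurable hvm, hmax, hmax, ← e]
    simp only [id]
    ring
  have hmeas : m1 + nm = m0 + np := by
    obtain ⟨Ω₀, hreg, hbi⟩ := hF.exists_regularSet
    have hloc : ∀ x ∈ Ω₀, ∃ B ∈ 𝓝 x, (m1 + nm).restrict B = (m0 + np).restrict B := by
      intro x hx
      obtain ⟨K, U, hU, hK⟩ := hbi x hx
      obtain ⟨r, hr, hrU⟩ := Metric.mem_nhds_iff.1
        (Filter.inter_mem hU (hreg.isOpen.mem_nhds hx))
      -- Halving the radius leaves room for the compact set of the local data: test functions vanish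
      -- off `ball x (r / 2)`, whose closed ball lies inside the chart `ball x r`.
      refine ⟨Metric.ball x (r / 2), Metric.ball_mem_nhds x (half_pos hr), ?_⟩
      refine restrict_eq_of_forall_lipschitz Metric.isOpen_ball fun g L hg hg1 hg0 => ?_
      have hd : LocalData Ω Ω₀ (Metric.ball x r) (Metric.closedBall x (r / 2)) T φ u D F K φmin :=
        { flow := hF
          isOpen := hΩ
          finite := hfin
          reg := hreg
          isOpen_chart := Metric.isOpen_ball
          chart_subset := hrU.trans inter_subset_right
          bilip := hK.mono (hrU.trans inter_subset_left)
          compact := isCompact_closedBall _ _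
          subset := Metric.closedBall_subset_ball (half_lt_self hr)
          porosity := hφ
          pos := hφmin
          le_porosity := hφpos
          velocity := hu
          divergence := hD
          weakDiv := hdiv }
      have hb := hd.integral_balance hτ hg hg1
        fun z hz => hg0 z fun hz' => hz (Metric.ball_subset_closedBall hz')
      have := key (memLp_top_of_bound hg.continuous.aestronglyMeasurable 1 (.of_forall hg1))
      rw [hb, sub_self] at this
      exact sub_eq_zero.1 this
    choose! B hB hBeq using hloc
    obtain ⟨c, hc, hcc, hcov⟩ := TopologicalSpace.countable_cover_nhdsWithin
      (f := B) (s := Ω₀) (fun x hx => mem_nhdsWithin_of_mem_nhds (hB x hx))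
    have hres := (Measure.restrict_biUnion_congr (μ := m1 + nm) (ν := m0 + np) hcc).2
      fun x hx => hBeq x (hc hx)
    -- All four measures are absolutely continuous with respect to `μ`, so the countable cover of
    -- `Ω₀` carries their whole mass and local equality becomes global.
    have hae : ∀ᵐ x ∂μ, x ∈ ⋃ i ∈ c, B i := (hreg.ae_mem hΩ).mono fun x hx => hcov hx
    rwa [Measure.restrict_eq_self_of_ae_mem ((hm1.add_left hnm).ae_le hae),
      Measure.restrict_eq_self_of_ae_mem ((hm0.add_left hnp).ae_le hae)] at hres
  have := key hv
  rw [hmeas, sub_self] at this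
  linarith

end GlobalBalance

/-! ### Measurability and boundedness of the frozen source -/

section Source

/-- Measurability of the composition with a Carathéodory function. -/
theorem aestronglyMeasurable_caratheodory {α : Type*} [MeasurableSpace α] {μ : Measure α}
    {h : ℝ → α → ℝ} (hm : ∀ r, AEStronglyMeasurable (h r) μ)
    (hc : ∀ᵐ y ∂μ, Continuous fun r => h r y) {v : α → ℝ} (hv : AEStronglyMeasurable v μ) :
    AEStronglyMeasurable (fun y => h (v y) y) μ := by
  obtain ⟨v', hv', hvv⟩ := hv
  have key : AEStronglyMeasurable (fun y => h (v' y) y) μ := by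
    -- For a simple function in place of `v'` the composition is a finite patchwork of the
    -- measurable `h r`; continuity in `r` passes to the limit.
    refine aestronglyMeasurable_of_tendsto_ae atTop
      (f := fun n y => ∑ r ∈ (hv'.approx n).range, ((hv'.approx n) ⁻¹' {r}).indicator (h r) y)
      (fun n => ?_) ?_
    · refine Finset.aestronglyMeasurable_fun_sum _ fun r _ => ?_
      exact (hm r).indicator ((hv'.approx n).measurableSet_preimage _)
    · filter_upwards [hc] with y hy
      refine ((hy.tendsto _).comp (hv'.tendsto_approx y)).congr fun n => ?_
      rw [Finset.sum_eq_single (hv'.approx n y)]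
      · rw [indicator_of_mem (by simp), Function.comp_apply]
      · intro r _ hr
        exact indicator_of_notMem (fun h => hr h.symm) _
      · intro hcon
        exact absurd (SimpleFunc.mem_range_self _ y) hcon
  exact key.congr (hvv.mono fun y hy => by simp only [hy])

variable {d : ℕ} {Ω : Set (Space d)} {T : ℝ} {f : ℝ → Space d → ℝ → ℝ} {τ : ℝ} {σ : Measure ℝ}
  {v : Space d → ℝ}

/-- Any instant is a limit of instants at which an almost sure property holds. -/
theorem exists_seq_tendsto_of_ae (hT : 0 < T) (hτ : τ ∈ Icc 0 T) {p : ℝ → Prop}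
    (hp : ∀ᵐ s ∂(volume.restrict (Ioo 0 T)), p s) :
    ∃ s : ℕ → ℝ, (∀ j, s j ∈ Ioo 0 T ∧ p (s j)) ∧ Tendsto s atTop (𝓝 τ) := by
  rw [ae_restrict_iff' measurableSet_Ioo] at hp
  have hd := Measure.dense_of_ae hp
  have hsub := closure_minimal (hd.open_subset_closure_inter (isOpen_Ioo (a := 0) (b := T)))
    isClosed_closure
  rw [closure_Ioo hT.ne] at hsub
  obtain ⟨s, hs, hlim⟩ := mem_closure_iff_seq_limit.1 (hsub hτ)
  exact ⟨s, fun j => ⟨(hs j).1, (hs j).2 (hs j).1⟩, hlim⟩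

/-- The frozen source is bounded. -/
theorem IsSource.memLp_frozenSource (hf : IsSource Ω T f) (hT : 0 < T) (hτ : τ ∈ Icc 0 T)
    (hσ : IsTimeSampling Ω T f τ σ) (hv : MemLp v ⊤ (volume.restrict Ω)) :
    MemLp (frozenSource f σ v) ⊤ (volume.restrict Ω) := by
  obtain ⟨L, hL⟩ := hf.lip
  have hb := ae_le_lpNorm_exponent_top hf.bdd
  set M := lpNorm (fun p : Space d × ℝ => f 0 p.1 p.2) ⊤ (cylinderMeasure Ω T)
  have hvb := ae_le_lpNorm_exponent_top hv
  set V := lpNorm v ⊤ (volume.restrict Ω)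
  have hbound : ∀ {k : ℝ → ℝ} {r : ℝ}, LipschitzWith L k → ‖k 0‖ ≤ M → ‖r‖ ≤ V →
      ‖k r‖ ≤ M + L * V := by
    intro k r hk h0 hr
    have h1 := hk.dist_le_mul r 0
    rw [dist_eq_norm, dist_zero_right] at h1
    have h2 : ‖k r‖ ≤ ‖k 0‖ + ‖k r - k 0‖ := by
      simpa using norm_add_le (k 0) (k r - k 0)
    have h3 : (L : ℝ) * ‖r‖ ≤ L * V := by gcongr
    linarith
  rcases hσ with ⟨rfl, hcont⟩ | ⟨hprob, hac⟩
  · have hswap : MeasurePreserving Prod.swap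
        ((volume.restrict (Ioo 0 T)).prod (volume.restrict Ω)) (cylinderMeasure Ω T) :=
      Measure.measurePreserving_swap
    -- The slice at `τ` is null in the cylinder, so hypotheses holding a.e. there say nothing about
    -- it directly. Continuity in time transfers them from good instants `s j` tending to `τ`.
    have htend : ∀ {x : Space d} {s : ℕ → ℝ}, (∀ r, ContinuousOn (fun s => f r x s) (Icc 0 T)) →
        (∀ j, s j ∈ Ioo 0 T) → Tendsto s atTop (𝓝 τ) →
        ∀ r, Tendsto (fun j => f r x (s j)) atTop (𝓝 (f r x τ)) := by
      intro x s hx hs hlim r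
      exact (hx r τ hτ).tendsto.comp (tendsto_nhdsWithin_iff.2
        ⟨hlim, .of_forall fun j => Ioo_subset_Icc_self (hs j)⟩)
    have hmeas : ∀ r, AEStronglyMeasurable (fun x => f r x τ) (volume.restrict Ω) := by
      intro r
      obtain ⟨s, hs, hlim⟩ := exists_seq_tendsto_of_ae hT hτ
        ((hf.meas r).comp_measurePreserving hswap).prodMk_left
      refine aestronglyMeasurable_of_tendsto_ae atTop (fun j => (hs j).2) ?_
      filter_upwards [hcont] with x hx using htend hx (fun j => (hs j).1) hlim r
    have hlip : ∀ᵐ x ∂(volume.restrict Ω),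
        LipschitzWith L (fun r => f r x τ) ∧ ‖f 0 x τ‖ ≤ M := by
      obtain ⟨s, hs, hlim⟩ := exists_seq_tendsto_of_ae hT hτ
        (Measure.ae_ae_of_ae_prod (hswap.quasiMeasurePreserving.ae (hL.and hb)))
      filter_upwards [hcont, ae_all_iff.2 fun j => (hs j).2] with x hx hx'
      have ht := htend hx (fun j => (hs j).1) hlim
      refine ⟨LipschitzWith.of_dist_le_mul fun a b => ?_, ?_⟩
      · exact le_of_tendsto ((ht a).dist (ht b))
          (.of_forall fun j => (hx' j).1.dist_le_mul a b)
      · exact le_of_tendsto (ht 0).norm (.of_forall fun j => (hx' j).2)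
    have heq : frozenSource f (Measure.dirac τ) v = fun x => f (v x) x τ := by
      ext x; exact integral_dirac _ _
    rw [heq]
    refine memLp_top_of_bound (aestronglyMeasurable_caratheodory (h := fun r x => f r x τ) hmeas
      (hlip.mono fun x hx => hx.1.continuous) hv.aestronglyMeasurable) (M + L * V) ?_
    filter_upwards [hlip, hvb] with x hx hx'
    exact hbound (k := fun r => f r x τ) hx.1 hx.2 hx'
  · have hac' : (volume.restrict Ω).prod σ ≪ cylinderMeasure Ω T :=
      Measure.AbsolutelyContinuous.rfl.prod hac
    have hvf : AEStronglyMeasurable (fun p : Space d × ℝ => v p.1) (cylinderMeasure Ω T) :=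
      hv.aestronglyMeasurable.comp_fst
    have hm := aestronglyMeasurable_caratheodory (h := fun r (p : Space d × ℝ) => f r p.1 p.2)
      hf.meas (hL.mono fun p hp => hp.continuous) hvf
    refine memLp_top_of_bound (hm.mono_ac hac').integral_prod_right' (M + L * V) ?_
    filter_upwards [Measure.ae_ae_of_ae_prod (hac'.ae_le (hL.and hb)), hvb] with x hx hx'
    refine (norm_integral_le_of_norm_le_const (C := M + L * V) ?_).trans_eq (by simp)
    filter_upwards [hx] with s hs
    exact hbound (k := fun r => f r x s) hs.1 hs.2 hx'

end Source

end MMOC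

/-! ### The mass balance error of the scheme -/

theorem mainTheorem2 {d : ℕ} (hd : 1 ≤ d) (Ω : Set (MMOC.Space d)) (hΩ : IsOpen Ω)
    (hΩb : Bornology.IsBounded Ω) (T : ℝ) (hT : 0 < T)
    {X : Type*} [AddCommGroup X] [Module ℝ X] [FiniteDimensional ℝ X]
    (C : MMOC.GradientDiscretisation Ω T X)
    (z₁ : X) (hz₁ : ∀ᵐ x ∂(volume.restrict Ω), C.recon z₁ x = 1)
    (φ : MMOC.Space d → ℝ) (hφ : MemLp φ ⊤ (volume.restrict Ω))
    (φmin : ℝ) (hφmin : 0 < φmin) (hφpos : ∀ᵐ x ∂(volume.restrict Ω), φmin ≤ φ x)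
    (f : ℝ → MMOC.Space d → ℝ → ℝ) (hf : MMOC.IsSource Ω T f)
    (σ : ℕ → Measure ℝ) (hσ : ∀ k ≤ C.N, MMOC.IsTimeSampling Ω T f (C.t k) (σ k))
    (u : ℕ → MMOC.Space d → MMOC.Space d) (divu : ℕ → MMOC.Space d → ℝ)
    (hu : ∀ n < C.N, MemLp (u (n + 1)) 2 (volume.restrict Ω))
    (hdivu : ∀ n < C.N, MemLp (divu (n + 1)) ⊤ (volume.restrict Ω))
    (hdiv : ∀ n < C.N, MMOC.IsWeakDiv Ω (u (n + 1)) (divu (n + 1)))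
    (F : ℕ → ℝ → MMOC.Space d → MMOC.Space d)
    (hF : ∀ n < C.N, MMOC.IsFlow Ω T φ (u (n + 1)) (F (n + 1)))
    (w : ℝ) (hw : w ∈ Icc (0 : ℝ) 1)
    (cini : Lp ℝ ⊤ (volume.restrict Ω)) (c : ℕ → X)
    (hc : MMOC.IsMMOCSolution C φ divu F f σ w cini c)
    (n : ℕ) (hn : n < C.N) :
    -- the integrals in the definition of the error and in its bound make sense
    IntegrableOn (MMOC.weighted w (MMOC.discreteSource C f σ c) n) Ω ∧
    (∀ m ∈ ({n, n + 1} : Set ℕ), Integrable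
      (fun p : ℝ × MMOC.Space d =>
        (C.recon (c n) (F (n + 1) (-p.1) p.2) - C.recon (c m) p.2) * divu (n + 1) p.2)
      ((volume.restrict (Ioc 0 (C.dt n))).prod (volume.restrict Ω))) ∧
    -- the estimate
    MMOC.massBalanceError C φ f σ w c n ≤
      w * |∫ t in (0 : ℝ)..(C.dt n), ∫ x in Ω,
          (C.recon (c n) (F (n + 1) (-t) x) - C.recon (c n) x) * divu (n + 1) x|
      + (1 - w) * |∫ t in (0 : ℝ)..(C.dt n), ∫ x in Ω,
          (C.recon (c n) (F (n + 1) (-t) x) - C.recon (c (n + 1)) x) * divu (n + 1) x| ∧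
    -- mass conservation for divergence free velocities
    ((∀ᵐ x ∂(volume.restrict Ω), divu (n + 1) x = 0) →
      MMOC.massBalanceError C φ f σ w c n = 0) := by
  have hT0 : 0 ≤ T := hT.le
  have hfin : volume Ω ≠ ∞ := hΩb.measure_lt_top.ne
  have : IsFiniteMeasure (volume.restrict Ω) := ⟨by simpa using hfin.lt_top⟩
  have hmono : MonotoneOn C.t (Icc 0 C.N) := by
    refine monotoneOn_of_le_succ ordConnected_Icc fun k _ _ hk => (C.t_lt k ?_).le
    exact Nat.lt_of_succ_le hk.2
  have htmem : ∀ k ≤ C.N, C.t k ∈ Icc 0 T := by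
    intro k hk
    have h0 := hmono (left_mem_Icc.2 (Nat.zero_le _)) ⟨Nat.zero_le k, hk⟩ (Nat.zero_le k)
    have h1 := hmono ⟨Nat.zero_le k, hk⟩ (right_mem_Icc.2 (Nat.zero_le _)) hk
    rw [C.t_zero] at h0
    rw [C.t_last] at h1
    exact ⟨h0, h1⟩
  have hdt0 : 0 ≤ C.dt n := sub_nonneg.2 (C.t_lt n hn).le
  have hdtT : C.dt n ≤ T := by
    have h1 := (htmem n hn.le).1
    have h2 := (htmem (n + 1) hn).2
    unfold MMOC.GradientDiscretisation.dt
    linarith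
  have hFn := hF n hn
  have hDb := hdivu n hn
  have hDi : IntegrableOn (divu (n + 1)) Ω := hDb.integrable le_top
  have hc' : ∀ k, MemLp (C.recon (c k)) ⊤ (volume.restrict Ω) := fun k => Lp.memLp _
  have hfr : ∀ k ≤ C.N, IntegrableOn (MMOC.discreteSource C f σ c k) Ω := fun k hk =>
    (hf.memLp_frozenSource hT (htmem k hk) (hσ k hk) (hc' k)).integrable le_top
  have hW : IntegrableOn (MMOC.weighted w (MMOC.discreteSource C f σ c) n) Ω :=
    ((hfr n hn.le).const_mul w).add ((hfr (n + 1) hn).const_mul (1 - w))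
  have hcD : ∀ k, IntegrableOn (fun x => divu (n + 1) x * C.recon (c k) x) Ω := fun k =>
    hDi.mul_bdd (hc' k).aestronglyMeasurable (ae_le_lpNorm_exponent_top (hc' k))
  have hprod := hFn.integrable_mul_comp_neg hΩ hT0 hdtT hDi (hc' n)
  have hprod' : ∀ k, Integrable
      (fun p : ℝ × MMOC.Space d => divu (n + 1) p.2 * C.recon (c k) p.2)
      ((volume.restrict (Ioc 0 (C.dt n))).prod (volume.restrict Ω)) := fun k =>
    (hcD k).comp_snd _
  have hintm : ∀ m, Integrable
      (fun p : ℝ × MMOC.Space d =>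
        (C.recon (c n) (F (n + 1) (-p.1) p.2) - C.recon (c m) p.2) * divu (n + 1) p.2)
      ((volume.restrict (Ioc 0 (C.dt n))).prod (volume.restrict Ω)) := by
    intro m
    refine (hprod.sub (hprod' m)).congr (.of_forall fun p => ?_)
    simp only [Pi.sub_apply]
    ring
  set I := ∫ t in (0 : ℝ)..(C.dt n), ∫ x in Ω,
    divu (n + 1) x * C.recon (c n) (F (n + 1) (-t) x) with hI
  let J : ℕ → ℝ := fun k => ∫ x in Ω, divu (n + 1) x * C.recon (c k) x
  have hA : ∀ m, ∫ t in (0 : ℝ)..(C.dt n), ∫ x in Ω,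
      (C.recon (c n) (F (n + 1) (-t) x) - C.recon (c m) x) * divu (n + 1) x =
        I - C.dt n * J m := by
    intro m
    have e : C.dt n * J m = ∫ _ in (0 : ℝ)..(C.dt n), J m := by
      rw [intervalIntegral.integral_const, sub_zero, smul_eq_mul]
    rw [e, hI, intervalIntegral.integral_of_le hdt0, intervalIntegral.integral_of_le hdt0,
      intervalIntegral.integral_of_le hdt0, integral_integral (hintm m), integral_integral hprod,
      integral_integral (hprod' m), ← integral_sub hprod (hprod' m)]
    refine integral_congr_ae (.of_forall fun p => ?_)
    simp only
    ring
  have hbal := hFn.integral_balance hΩ hfin hφ hφmin hφpos ((hu n hn).integrable (by norm_num))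
    hDi (hdiv n hn) ⟨hdt0, hdtT⟩ (hc' n)
  have hscheme := hc.2 n hn z₁
  have hz : ∀ {h : MMOC.Space d → ℝ}, ∫ x in Ω, h x * C.recon z₁ x = ∫ x in Ω, h x := by
    intro h
    refine integral_congr_ae ?_
    filter_upwards [hz₁] with x hx
    rw [hx, mul_one]
  rw [hz, hz, hz] at hscheme
  have hsplit : ∫ x in Ω, (MMOC.weighted w (MMOC.discreteSource C f σ c) n x
      - MMOC.weighted w (fun k => C.recon (c k)) n x * divu (n + 1) x) =
      (∫ x in Ω, MMOC.weighted w (MMOC.discreteSource C f σ c) n x)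
        - (w * J n + (1 - w) * J (n + 1)) := by
    have e : w * J n + (1 - w) * J (n + 1) =
        ∫ x in Ω, (w * (divu (n + 1) x * C.recon (c n) x)
          + (1 - w) * (divu (n + 1) x * C.recon (c (n + 1)) x)) := by
      rw [integral_add ((hcD n).const_mul w) ((hcD (n + 1)).const_mul (1 - w)),
        integral_const_mul, integral_const_mul]
    have hV : IntegrableOn (fun x => w * (divu (n + 1) x * C.recon (c n) x)
        + (1 - w) * (divu (n + 1) x * C.recon (c (n + 1)) x)) Ω :=
      ((hcD n).const_mul w).add ((hcD (n + 1)).const_mul (1 - w))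
    rw [e, ← integral_sub hW hV]
    refine integral_congr_ae (.of_forall fun x => ?_)
    simp only [MMOC.weighted]
    ring
  rw [hsplit] at hscheme
  have hest : MMOC.massBalanceError C φ f σ w c n ≤
      w * |∫ t in (0 : ℝ)..(C.dt n), ∫ x in Ω,
          (C.recon (c n) (F (n + 1) (-t) x) - C.recon (c n) x) * divu (n + 1) x|
      + (1 - w) * |∫ t in (0 : ℝ)..(C.dt n), ∫ x in Ω,
          (C.recon (c n) (F (n + 1) (-t) x) - C.recon (c (n + 1)) x) * divu (n + 1) x| := by
    rw [hA, hA, MMOC.massBalanceError]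
    -- Adding the scheme and the balance cancels `∫ φ Πc⁽ⁿ⁾ ∘ F_{-δt}`; the remaining `I` is then
    -- split as `w * I + (1 - w) * I`.
    have e : (∫ x in Ω, φ x * C.recon (c (n + 1)) x) - (∫ x in Ω, φ x * C.recon (c n) x)
        - C.dt n * ∫ x in Ω, MMOC.weighted w (MMOC.discreteSource C f σ c) n x =
        w * (I - C.dt n * J n) + (1 - w) * (I - C.dt n * J (n + 1)) := by
      linear_combination hscheme - hbal
    rw [e]
    refine (abs_add_le _ _).trans_eq ?_
    rw [abs_mul, abs_mul, abs_of_nonneg hw.1, abs_of_nonneg (sub_nonneg.2 hw.2)]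
  refine ⟨hW, fun m _ => hintm m, hest, fun hdiv0 => ?_⟩
  refine le_antisymm (hest.trans_eq ?_) (abs_nonneg _)
  have hzero : ∀ (t : ℝ) (m : ℕ), ∫ x in Ω,
      (C.recon (c n) (F (n + 1) (-t) x) - C.recon (c m) x) * divu (n + 1) x = 0 := by
    intro t m
    refine integral_eq_zero_of_ae ?_
    filter_upwards [hdiv0] with x hx
    rw [hx, mul_zero, Pi.zero_apply]
  simp [hzero]
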